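/- Let $\mathcal M\subseteq\mathbb B(H)$ and $\mathcal N\subseteq\mathbb B(K)$ be von Neumann algebras (for instance $K=L^2(\mathcal N)$, the standard form), and let $\mathrm{CP}(\mathcal M,\mathcal N)$ be the set of completely positive linear maps $\mathcal M\to\mathcal N$, with the order $\Theta\le_{\mathrm{cp}}\Phi$ meaning that $\Phi-\Theta$ is completely positive. For $\Phi,\Psi\in\mathrm{CP}(\mathcal M,\mathcal N)$: - $\Psi\ll\Phi$ means that there are $\Psi_n\in\mathrm{CP}(\mathcal M,\mathcal N)$, increasing for $\le_{\mathrm{cp}}$ and converging to $\Psi$ in the point-ultraweak topology, and real numbers $\alpha_n>0$ with $\Psi_n\le_{\mathrm{cp}}\alpha_n\Phi$ for all $n$. - $\Psi\perp\Phi$ means that $\Theta=0$ is the only $\Theta\in\mathrm{CP}(\mathcal M,\mathcal N)$ with $\Theta\le_{\mathrm{cp}}\Phi$ and $\Theta\le_{\mathrm{cp}}\Psi$. - $s_\Phi$ is the positive sesquilinear form on the algebraic tensor product $\mathcal M\odot K$ with $s_\Phi(x\otimes\xi,y\otimes\eta)=\langle\Phi(y^*x)\xi,\eta\rangle$. The parallel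 sum $\Phi:\Psi\in\mathrm{CP}(\mathcal M,\mathcal N)$ is the map with $s_{\Phi:\Psi}(z,z)=\inf\{s_\Phi(x,x)+s_\Psi(y,y) : x+y=z\}$ for all $z\in\mathcal M\odot K$. - The Lebesgue decomposition of $\Psi$ with respect to $\Phi$ is $\Psi=\Psi_{\mathrm{ac}}+\Psi_{\mathrm s}$, where $\Psi_{\mathrm{ac}}=\lim_{n\to\infty}(n\Phi:\Psi)$ in the point-ultraweak topology and $\Psi_{\mathrm s}=\Psi-\Psi_{\mathrm{ac}}$. **Theorem.** Let $\Phi,\Psi\in\mathrm{CP}(\mathcal M,\mathcal N)$ and $\Gamma=\Phi+\Psi$. Let $(\pi,V,\mathcal H_\gamma)$ be a minimal Stinespring representation of $\Gamma$, that is, $\pi$ is a unital $*$-representation of $\mathcal M$ on the Hilbert space $\mathcal H_\gamma$ and $V\colon K\to\mathcal H_\gamma$ is bounded linear, with $\Gamma(x)=V^*\pi(x)V$ for all $x\in\mathcal M$ and $\overline{\mathrm{span}}\{\pi(x)V\xi : x\in\mathcal M,\ \xi\in K\}=\mathcal H_\gamma$. There are unique positive operators $A',B'\in\pi(\mathcal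 M)'$, the Arveson Radon–Nikodym derivatives of $\Phi$ and $\Psi$, such that $\Phi(x)=V^*A'\pi(x)V$ and $\Psi(x)=V^*B'\pi(x)V$ for all $x\in\mathcal M$. Set $E_\Phi=\overline{\mathrm{ran}}(A')$ and $E_\Psi=\overline{\mathrm{ran}}(B')$, and let $P'_\Phi,P'_\Psi$ be the orthogonal projections onto $E_\Phi,E_\Psi$ (the support projections of $A',B'$). Then $P'_\Phi,P'_\Psi\in\pi(\mathcal M)'$. The Lebesgue decomposition $\Psi=\Psi_{\mathrm{ac}}+\Psi_{\mathrm s}$ of $\Psi$ with respect to $\Phi$ exists in $\mathrm{CP}(\mathcal M,\mathcal N)$, with $\Psi_{\mathrm{ac}}\ll\Phi$ and $\Psi_{\mathrm s}\perp\Phi$, and for all $x\in\mathcal M$ $$\Psi_{\mathrm{ac}}(x)=V^*(P'_\Phi B'P'_\Phi)\pi(x)V,\qquad \Psi_{\mathrm s}(x)=V^*\big((I-P'_\Phi)B'(I-P'_\Phi)\big)\pi(x)V .$$ Moreover: 1. $\Psi\ll\Phi\iff E_\Psi\subseteq E_\Phi\iff P'_\Psi\le P'_\Phi$; 2. $\Psi\perp\Phi\iff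 E_\Psi\perp E_\Phi\iff P'_\Psi P'_\Phi=0$. -/

import Mathlib

open Filter Topology
open scoped TensorProduct InnerProductSpace CStarAlgebra

universe u v w

section VonNeumann

variable {H : Type u} [NormedAddCommGroup H] [InnerProductSpace ℂ H] [CompleteSpace H]

/-! A von Neumann algebra on `H` is a unital C⋆-algebra, ordered as operators on `H`. -/

instance VonNeumannAlgebra.instSMulMemClass :
    SMulMemClass (VonNeumannAlgebra H) ℂ (H →L[ℂ] H) where
  smul_mem {M} c _ hx := M.toStarSubalgebra.smul_mem hx c

instance VonNeumannAlgebra.instIsClosed (M : VonNeumannAlgebra H) :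
    IsClosed (M : Set (H →L[ℂ] H)) := by
  rw [← M.centralizer_centralizer]
  exact Set.isClosed_centralizer _

noncomputable instance VonNeumannAlgebra.instCStarAlgebra (M : VonNeumannAlgebra H) :
    CStarAlgebra M :=
  StarSubalgebra.cstarAlgebra M

/-- The order on `M` is the operator (Loewner) order inherited from `B(H)`; positive elements are
exactly those of the form `s⋆ s` with `s ∈ M`. -/
instance VonNeumannAlgebra.instStarOrderedRing (M : VonNeumannAlgebra H) :
    StarOrderedRing M := by
  refine StarOrderedRing.of_le_iff fun x y => ⟨fun h => ?_, ?_⟩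
  · have ha : 0 ≤ ((y - x : M) : H →L[ℂ] H) := by
      simpa using (sub_nonneg.mpr (show (x : H →L[ℂ] H) ≤ y from h))
    have hsa : IsSelfAdjoint (y - x) := Subtype.ext (IsSelfAdjoint.of_nonneg ha).star_eq
    have hq : QuasispectrumRestricts (y - x) ContinuousMap.realToNNReal := by
      rw [quasispectrumRestricts_iff_spectrumRestricts, SpectrumRestricts.nnreal_iff]
      intro r hr
      have hspec : spectrum ℂ (y - x) = spectrum ℂ ((y - x : M) : H →L[ℂ] H) :=
        StarSubalgebra.spectrum_eq M.toStarSubalgebra (hS := M.instIsClosed) (a := y - x)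
      rw [← spectrum.algebraMap_mem_iff ℂ, hspec, spectrum.algebraMap_mem_iff] at hr
      exact spectrum_nonneg_of_nonneg ha hr
    obtain ⟨s, hs, -, hs'⟩ :=
      CFC.exists_sqrt_of_isSelfAdjoint_of_quasispectrumRestricts hsa hq
    exact ⟨s, by rw [hs.star_eq, hs', add_sub_cancel]⟩
  · rintro ⟨s, rfl⟩
    change (x : H →L[ℂ] H) ≤ ((x + star s * s : M) : H →L[ℂ] H)
    have : 0 ≤ star (s : H →L[ℂ] H) * (s : H →L[ℂ] H) := star_mul_self_nonneg _
    simp [this]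

end VonNeumann

namespace CPLebesgue

section Maps

variable {H : Type u} [NormedAddCommGroup H] [InnerProductSpace ℂ H] [CompleteSpace H]
variable {K : Type v} [NormedAddCommGroup K] [InnerProductSpace ℂ K] [CompleteSpace K]
variable {M : VonNeumannAlgebra H} {N : VonNeumannAlgebra K}

/-- The order `f ≤_cp g`: the difference `g - f` is completely positive. -/
def CPLe (f g : M →ₗ[ℂ] N) : Prop :=
  ∃ Δ : M →CP N, Δ.toLinearMap = g - f

/-- The ultraweak (σ-weak) topology on `B(K)`: the coarsest topology making all functionals
`T ↦ ∑ₖ ⟪ξₖ, T ηₖ⟫` with `∑ₖ ‖ξₖ‖² < ∞` and `∑ₖ ‖ηₖ‖² < ∞` continuous. -/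
@[reducible]
noncomputable def ultraweakTopology (K : Type v) [NormedAddCommGroup K] [InnerProductSpace ℂ K] :
    TopologicalSpace (K →L[ℂ] K) :=
  ⨅ (ξ : lp (fun _ : ℕ => K) 2) (η : lp (fun _ : ℕ => K) 2),
    TopologicalSpace.induced (fun T : K →L[ℂ] K => ∑' k, ⟪ξ k, T (η k)⟫_ℂ) inferInstance

/-- Convergence of a sequence of maps in the point-ultraweak topology. -/
def PointUltraweakTendsto (F : ℕ → (M →CP N)) (G : M →CP N) : Prop :=
  ∀ x : M, Tendsto (fun n => ((F n x : N) : K →L[ℂ] K)) atTop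
    (@nhds _ (ultraweakTopology K) ((G x : N) : K →L[ℂ] K))

/-- `Ψ ≪ Φ`: there are completely positive `Ψₙ ↑ Ψ` (increasing for `≤_cp`, with point-ultraweak
limit `Ψ`) and reals `αₙ > 0` with `Ψₙ ≤_cp αₙ Φ` for all `n`. -/
def AbsolutelyContinuous (Ψ Φ : M →CP N) : Prop :=
  ∃ (F : ℕ → (M →CP N)) (α : ℕ → ℝ),
    (∀ n, CPLe (F n).toLinearMap (F (n + 1)).toLinearMap) ∧
    PointUltraweakTendsto F Ψ ∧
    ∀ n, 0 < α n ∧ CPLe (F n).toLinearMap ((α n : ℂ) • Φ.toLinearMap)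

/-- `Ψ ⊥ Φ`: the only completely positive map dominated by both `Φ` and `Ψ` is zero. -/
def Singular (Ψ Φ : M →CP N) : Prop :=
  ∀ Θ : M →CP N, CPLe Θ.toLinearMap Φ.toLinearMap → CPLe Θ.toLinearMap Ψ.toLinearMap →
    Θ.toLinearMap = 0

/-- The sesquilinear form `s_f` on the algebraic tensor product `M ⊙ K` with
`s_f (y ⊗ η, x ⊗ ξ) = ⟪η, f (y⋆ x) ξ⟫`, conjugate-linear in the first variable. -/
noncomputable def sForm (f : M →ₗ[ℂ] N) : (M ⊗[ℂ] K) →ₗ⋆[ℂ] (M ⊗[ℂ] K) →ₗ[ℂ] ℂ :=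
  TensorProduct.lift <|
    LinearMap.mk₂'ₛₗ (starRingEnd ℂ) (starRingEnd ℂ)
      (fun (y : M) (η : K) => TensorProduct.lift <|
        LinearMap.mk₂ ℂ (fun (x : M) (ξ : K) => ⟪η, ((f (star y * x) : N) : K →L[ℂ] K) ξ⟫_ℂ)
          (by intros; simp [mul_add])
          (by intros; simp)
          (by intros; simp)
          (by intros; simp))
      (by intros; ext; simp [add_mul])
      (by intros; ext; simp)
      (by intros; ext; simp)
      (by intros; ext; simp [mul_comm])

theorem sForm_tmul (f : M →ₗ[ℂ] N) (y x : M) (η ξ : K) :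
    sForm f (y ⊗ₜ η) (x ⊗ₜ ξ) = ⟪η, ((f (star y * x) : N) : K →L[ℂ] K) ξ⟫_ℂ := by
  simp [sForm]

/-- `θ` is the parallel sum `f : g`, i.e. its form is the parallel sum of the forms of `f`
and `g`: `s_θ (z, z) = inf {s_f (x, x) + s_g (y, y) | x + y = z}`. -/
def IsParallelSum (f g θ : M →ₗ[ℂ] N) : Prop :=
  ∀ z : M ⊗[ℂ] K, IsGLB {r : ℝ | ∃ x y : M ⊗[ℂ] K, x + y = z ∧
    r = (sForm f x x).re + (sForm g y y).re} (sForm θ z z).re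

/-- `Ψac = [Φ]Ψ`, the point-ultraweak limit of the parallel sums `nΦ : Ψ` as `n → ∞`. -/
def IsAbsolutelyContinuousPart (Φ Ψ Ψac : M →CP N) : Prop :=
  ∃ F : ℕ → (M →CP N),
    (∀ n : ℕ, IsParallelSum ((n : ℂ) • Φ.toLinearMap) Ψ.toLinearMap (F n).toLinearMap) ∧
    PointUltraweakTendsto F Ψac

/-- The Lebesgue decomposition `Ψ = Ψac + Ψs` with respect to `Φ`, with `Ψac = [Φ]Ψ`. -/
structure IsLebesgueDecomposition (Φ Ψ Ψac Ψs : M →CP N) : Prop where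
  isAbsolutelyContinuousPart : IsAbsolutelyContinuousPart Φ Ψ Ψac
  eq_add : Ψ.toLinearMap = Ψac.toLinearMap + Ψs.toLinearMap

variable {L : Type w} [NormedAddCommGroup L] [InnerProductSpace ℂ L] [CompleteSpace L]

/-- `(π, V, L)` is a minimal Stinespring representation of `f`: `f(x) = V⋆ π(x) V`, and the
vectors `π(x) V ξ` span a dense subspace of `L`. -/
structure IsMinimalStinespring (f : M →ₗ[ℂ] N) (π : M →⋆ₐ[ℂ] (L →L[ℂ] L))
    (V : K →L[ℂ] L) : Prop where
  eq_compression : ∀ x : M,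
    ((f x : N) : K →L[ℂ] K) = ContinuousLinearMap.adjoint V ∘L π x ∘L V
  dense_span : (Submodule.span ℂ {ζ : L | ∃ (x : M) (ξ : K), ζ = π x (V ξ)}).topologicalClosure = ⊤

/-- The commutant `π(M)'` in `B(L)`. -/
def repCommutant (π : M →⋆ₐ[ℂ] (L →L[ℂ] L)) : Set (L →L[ℂ] L) :=
  Set.centralizer (Set.range π)

/-- `T` is an Arveson Radon–Nikodym derivative of `f` in `(π, V, L)`: a positive operator in
`π(M)'` with `f(x) = V⋆ T π(x) V`. -/
structure IsArvesonDerivative (π : M →⋆ₐ[ℂ] (L →L[ℂ] L)) (V : K →L[ℂ] L)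
    (f : M →ₗ[ℂ] N) (T : L →L[ℂ] L) : Prop where
  mem_commutant : T ∈ repCommutant π
  isPositive : T.IsPositive
  eq_compression : ∀ x : M,
    ((f x : N) : K →L[ℂ] K) = ContinuousLinearMap.adjoint V ∘L T ∘L π x ∘L V

/-- The closure of the range of `T`. -/
def closedRange (T : L →L[ℂ] L) : Submodule ℂ L :=
  (LinearMap.range (T : L →ₗ[ℂ] L)).topologicalClosure

instance (T : L →L[ℂ] L) : CompleteSpace (closedRange T) :=
  (Submodule.isClosed_topologicalClosure _).completeSpace_coe

/-- The support projection of a positive operator `T`: the orthogonal projection onto the closure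
of its range. -/
noncomputable def supportProj (T : L →L[ℂ] L) : L →L[ℂ] L :=
  (closedRange T).starProjection

end Maps

end CPLebesgue

set_option linter.unusedSectionVars false

/-! Completely positive maps dominated by a multiple of `Γ` correspond to positive operators in
`π(M)'`, the order `≤_cp` becoming the operator order. Under this dictionary the theorem concerns
two positive operators. Uniqueness of the derivative of `Γ` gives `A + B = 1`, so `A` and `B`
commute and everything is a function of `A`.

Write `P` for the support projection of `A`. Completing the square shows that `nΦ : Ψ` has
derivative `B - B(nA + B)⁻¹B`, where `nA + B = 1 + (n-1)A` for `n ≥ 1`. The resolvents `(1 + mA)⁻¹`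
converge strongly to `1 - P`, the projection onto `ker A`, on which `B` is the identity. Hence the
limit is `B - B(1 - P)B = BP`, and the singular part has derivative `B(1 - P) = 1 - P`.

One point is not operator theory: a positive `T` in `π(M)'` compresses to a map into `B(K)`, with no
reason to land in `N`. Each unitary `u` of `N'` is therefore implemented on `L` by some `W` with `W
π(x) V = π(x) V u`. Derivatives of `N`-valued maps commute with all such `W`, and conversely any `T`
commuting with `π(M)` and every `W` has compressions in `N'' = N` (`compression_mem`). The operators
above are built from `A` and `B` inside this commutant, so they come from maps into `N`.

For the equivalences, `Ψ ≪ Φ` forces `ker A ⊆ ker B` by approximating with operators that vanish on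
`ker A`, while `Ψ ⊥ Φ` is tested on the map with derivative `AB`, which lies below both `A` and `B`.
-/

namespace CPLebesgue

/-! ### Negative parts in C⋆-algebras -/

section CStarAlgebra

variable {A : Type*} [NonUnitalCStarAlgebra A] [PartialOrder A] [StarOrderedRing A]

theorem exists_eq_star_mul_self {a : A} (ha : 0 ≤ a) : ∃ b : A, a = star b * b :=
  CStarAlgebra.nonneg_iff_eq_star_mul_self.mp ha

/-- A self-adjoint element is compressed by its negative part to the negative of a square, which
vanishes only if the element is nonnegative. -/
theorem exists_compression_eq_neg {a : A} (ha : IsSelfAdjoint a) :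
    ∃ p s : A, star p * (a * p) = -(star s * s) ∧ (s = 0 → 0 ≤ a) := by
  have hp : 0 ≤ a⁻ := CFC.negPart_nonneg a
  have hps : star a⁻ = a⁻ := hp.isSelfAdjoint.star_eq
  obtain ⟨b, hb⟩ := exists_eq_star_mul_self hp
  -- As `a a⁻ = -(a⁻)²`, the compression by `a⁻` is `-(a⁻)³`; the factorization `a⁻ = b⋆b` turns
  -- this cube into `(b a⁻)⋆(b a⁻)`.
  refine ⟨a⁻, b * a⁻, ?_, fun h => ?_⟩
  · have h1 : a * a⁻ = -(a⁻ * a⁻) := by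
      nth_rewrite 1 [← CFC.posPart_sub_negPart a ha]
      rw [sub_mul, CFC.posPart_mul_negPart, zero_sub]
    rw [h1, mul_neg, star_mul, mul_assoc, ← mul_assoc (star b), ← hb]
  · have h2 : star a⁻ * a⁻ = 0 := by
      nth_rewrite 1 [hps, hb]
      rw [mul_assoc, h, mul_zero]
    rw [CStarRing.star_mul_self_eq_zero_iff] at h2
    rw [← CFC.posPart_sub_negPart a ha, h2, sub_zero]
    exact CFC.posPart_nonneg a

end CStarAlgebra

/-! ### Positivity of matrices over `N` through their forms -/

section MatrixForms

variable {K : Type v} [NormedAddCommGroup K] [InnerProductSpace ℂ K] [CompleteSpace K]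
variable {N : VonNeumannAlgebra K} {n : Type*} [Fintype n]

/-- A matrix over `N` acting on tuples of vectors. -/
def matVec (X : CStarMatrix n n N) (η : n → K) (i : n) : K :=
  ∑ j, ((X i j : N) : K →L[ℂ] K) (η j)

/-- The sesquilinear form of a matrix over `N`. -/
noncomputable def matForm (X : CStarMatrix n n N) (ζ η : n → K) : ℂ :=
  ∑ i, ⟪ζ i, matVec X η i⟫_ℂ

theorem matVec_mul (X Y : CStarMatrix n n N) (η : n → K) :
    matVec (X * Y) η = matVec X (matVec Y η) := by
  ext i
  simp only [matVec, CStarMatrix.mul_apply, map_sum]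
  rw [Finset.sum_comm]
  refine Finset.sum_congr rfl fun j _ => ?_
  simp

theorem matForm_star_mul (X Y : CStarMatrix n n N) (ζ η : n → K) :
    matForm (star X * Y) ζ η = ∑ i, ⟪matVec X ζ i, matVec Y η i⟫_ℂ := by
  unfold matForm
  rw [matVec_mul]
  set θ := matVec Y η
  simp only [matVec, inner_sum, sum_inner]
  rw [Finset.sum_comm]
  refine Finset.sum_congr rfl fun i _ => Finset.sum_congr rfl fun j _ => ?_
  rw [CStarMatrix.star_apply]
  simp [ContinuousLinearMap.star_eq_adjoint, ContinuousLinearMap.adjoint_inner_right]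

theorem matForm_star_mul_self (X : CStarMatrix n n N) (η : n → K) :
    matForm (star X * X) η η = ((∑ i, ‖matVec X η i‖ ^ 2 : ℝ) : ℂ) := by
  rw [matForm_star_mul]
  push_cast
  exact Finset.sum_congr rfl fun i _ => inner_self_eq_norm_sq_to_K _

theorem matForm_nonneg {X : CStarMatrix n n N} (hX : 0 ≤ X) (η : n → K) :
    0 ≤ (matForm X η η).re := by
  obtain ⟨Y, rfl⟩ := exists_eq_star_mul_self hX
  rw [matForm_star_mul_self, Complex.ofReal_re]
  positivity

theorem eq_zero_of_matVec_eq_zero {X : CStarMatrix n n N} (h : ∀ η, matVec X η = 0) : X = 0 := by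
  classical
  refine CStarMatrix.ext fun i j => Subtype.ext (ContinuousLinearMap.ext fun ξ => ?_)
  have := congrFun (h (Pi.single j ξ)) i
  simp only [matVec, Pi.single_apply] at this
  rw [Finset.sum_eq_single j (by intro b _ hb; simp [hb]) (by simp)] at this
  simpa using this

/-- A self-adjoint matrix over `N` with nonnegative form is nonnegative. -/
theorem nonneg_of_matForm_nonneg {X : CStarMatrix n n N} (hX : IsSelfAdjoint X)
    (h : ∀ η, 0 ≤ (matForm X η η).re) : 0 ≤ X := by
  obtain ⟨P, S, hPS, hS⟩ := exists_compression_eq_neg hX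
  refine hS (eq_zero_of_matVec_eq_zero fun η => ?_)
  -- At the vector `P η` the form of `X` is nonnegative by hypothesis, yet equals `-‖S η‖²` by the
  -- choice of `P` and `S`.
  have h1 := h (matVec P η)
  have h2 : matForm X (matVec P η) (matVec P η) = -((∑ i, ‖matVec S η i‖ ^ 2 : ℝ) : ℂ) := by
    rw [← matForm_star_mul_self]
    have h3 : matForm (star P * (X * P)) η η = matForm (-(star S * S)) η η := by rw [hPS]
    rw [matForm_star_mul, matVec_mul] at h3
    rw [matForm, h3]
    simp only [matForm, matVec, CStarMatrix.neg_apply]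
    simp [inner_sum]
  rw [h2, Complex.neg_re, Complex.ofReal_re, neg_nonneg] at h1
  have h4 := (Finset.sum_eq_zero_iff_of_nonneg fun i _ => sq_nonneg ‖matVec S η i‖).mp
    (le_antisymm h1 (by positivity))
  ext i
  simpa using h4 i (Finset.mem_univ i)

end MatrixForms

/-! ### Complete positivity in terms of the form `s_f` -/

section Maps

variable {H : Type u} [NormedAddCommGroup H] [InnerProductSpace ℂ H] [CompleteSpace H]
variable {K : Type v} [NormedAddCommGroup K] [InnerProductSpace ℂ K] [CompleteSpace K]
variable {M : VonNeumannAlgebra H} {N : VonNeumannAlgebra K}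

theorem sForm_sum_tmul (f : M →ₗ[ℂ] N) {ι : Type*} (s : Finset ι) (x y : ι → M) (ξ η : ι → K) :
    sForm f (∑ i ∈ s, y i ⊗ₜ η i) (∑ j ∈ s, x j ⊗ₜ ξ j) =
      ∑ i ∈ s, ∑ j ∈ s, ⟪η i, ((f (star (y i) * x j) : N) : K →L[ℂ] K) (ξ j)⟫_ℂ := by
  rw [Finset.sum_comm]
  simp [map_sum, sForm_tmul]

theorem sForm_self_nonneg (f : M →CP N) (z : M ⊗[ℂ] K) :
    0 ≤ (sForm f.toLinearMap z z).re := by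
  classical
  obtain ⟨S, rfl⟩ := TensorProduct.exists_finset z
  rcases S.eq_empty_or_nonempty with rfl | ⟨i₀, hi₀⟩
  · simp
  -- The matrix with the coefficients `x_j` in a single row `i₀` and zeros elsewhere, so that `X⋆X`
  -- has entries `x_i⋆ x_j`.
  let X : CStarMatrix S S M := CStarMatrix.ofMatrix fun i j => if i = ⟨i₀, hi₀⟩ then j.1.1 else 0
  have hX' : ∀ i j, X i j = if i = ⟨i₀, hi₀⟩ then j.1.1 else 0 := fun _ _ => rfl
  have hX : 0 ≤ star X * X := star_mul_self_nonneg X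
  have h := matForm_nonneg (f.map_cstarMatrix_nonneg _ hX) (fun j : S => j.1.2)
  have hXij : ∀ i j : S, (star X * X) i j = star i.1.1 * j.1.1 := by
    intro i j
    rw [CStarMatrix.mul_apply, Finset.sum_eq_single ⟨i₀, hi₀⟩]
    · simp [hX', CStarMatrix.star_apply]
    · intro b _ hb
      simp [hX', hb]
    · simp
  rw [sForm_sum_tmul]
  convert h using 2
  simp only [matForm, matVec, CStarMatrix.map_apply, hXij, inner_sum]
  rw [← Finset.sum_coe_sort S]
  refine Finset.sum_congr rfl fun i _ => ?_
  rw [← Finset.sum_coe_sort S]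
  rfl

/-- Writing a positive matrix as `Y⋆Y` splits the form of its image into one value of `s_f` per row
of `Y`. Compatibility with `⋆` is a separate hypothesis because `hf` sees only real parts and gives
no self-adjointness. -/
theorem exists_completelyPositiveMap (f : M →ₗ[ℂ] N) (hstar : ∀ x, f (star x) = star (f x))
    (hf : ∀ z : M ⊗[ℂ] K, 0 ≤ (sForm f z z).re) : ∃ F : M →CP N, F.toLinearMap = f := by
  refine ⟨⟨f, fun k X hX => ?_⟩, rfl⟩
  obtain ⟨Y, rfl⟩ := exists_eq_star_mul_self hX
  refine nonneg_of_matForm_nonneg ?_ fun η => ?_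
  · refine CStarMatrix.ext fun i j => ?_
    rw [CStarMatrix.star_apply, CStarMatrix.map_apply, CStarMatrix.map_apply, ← hstar,
      ← CStarMatrix.star_apply, star_mul, star_star]
  · have h : matForm ((star Y * Y).map f) η η =
        ∑ l, sForm f (∑ j, Y l j ⊗ₜ η j) (∑ j, Y l j ⊗ₜ η j) := by
      rw [Finset.sum_congr rfl fun l _ =>
        sForm_sum_tmul f Finset.univ (fun j => Y l j) (fun j => Y l j) η η, Finset.sum_comm]
      refine Finset.sum_congr rfl fun i _ => ?_
      rw [Finset.sum_comm, matVec, inner_sum]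
      refine Finset.sum_congr rfl fun j _ => ?_
      simp only [CStarMatrix.map_apply, CStarMatrix.mul_apply, map_sum, CStarMatrix.star_apply]
      simp [inner_sum]
    rw [h, Complex.re_sum]
    exact Finset.sum_nonneg fun l _ => hf _

theorem sForm_conj_symm {f : M →ₗ[ℂ] N} (hstar : ∀ x, f (star x) = star (f x))
    (z w : M ⊗[ℂ] K) : starRingEnd ℂ (sForm f z w) = sForm f w z := by
  induction z with
  | zero => simp
  | add z₁ z₂ h₁ h₂ => simp [h₁, h₂]
  | tmul y η =>
    induction w with
    | zero => simp
    | add w₁ w₂ h₁ h₂ => simp [h₁, h₂]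
    | tmul x ξ =>
      rw [sForm_tmul, sForm_tmul, inner_conj_symm, ← star_star (star y * x), hstar, star_mul,
        star_star]
      exact ContinuousLinearMap.adjoint_inner_left _ _ _

theorem CompletelyPositiveMap.apply_star (f : M →CP N) (x : M) :
    f.toLinearMap (star x) = star (f.toLinearMap x) :=
  map_star f x

theorem sForm_add (f g : M →ₗ[ℂ] N) (z w : M ⊗[ℂ] K) :
    sForm (f + g) z w = sForm f z w + sForm g z w := by
  induction z with
  | zero => simp
  | add z₁ z₂ h₁ h₂ => simp only [map_add, LinearMap.add_apply, h₁, h₂]; ring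
  | tmul y η =>
    induction w with
    | zero => simp
    | add w₁ w₂ h₁ h₂ => simp only [map_add, h₁, h₂]; ring
    | tmul x ξ => simp [sForm_tmul]

theorem sForm_smul (c : ℂ) (f : M →ₗ[ℂ] N) (z w : M ⊗[ℂ] K) :
    sForm (c • f) z w = c * sForm f z w := by
  induction z with
  | zero => simp
  | add z₁ z₂ h₁ h₂ => simp only [map_add, LinearMap.add_apply, h₁, h₂]; ring
  | tmul y η =>
    induction w with
    | zero => simp
    | add w₁ w₂ h₁ h₂ => simp only [map_add, h₁, h₂]; ring
    | tmul x ξ => simp [sForm_tmul]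

theorem sForm_sub (f g : M →ₗ[ℂ] N) (z w : M ⊗[ℂ] K) :
    sForm (f - g) z w = sForm f z w - sForm g z w := by
  have h := sForm_add (f - g) g z w
  rw [sub_add_cancel] at h
  rw [h, add_sub_cancel_right]

theorem CPLe.sForm_le {f g : M →ₗ[ℂ] N} (h : CPLe f g) (z : M ⊗[ℂ] K) :
    (sForm f z z).re ≤ (sForm g z z).re := by
  obtain ⟨Δ, hΔ⟩ := h
  have := sForm_self_nonneg Δ z
  rw [hΔ, sForm_sub, Complex.sub_re] at this
  linarith

theorem cpLe_of_sForm_le {f g : M →ₗ[ℂ] N} (hf : ∀ x, f (star x) = star (f x))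
    (hg : ∀ x, g (star x) = star (g x))
    (h : ∀ z : M ⊗[ℂ] K, (sForm f z z).re ≤ (sForm g z z).re) : CPLe f g := by
  refine exists_completelyPositiveMap (g - f) (fun x => ?_) fun z => ?_
  · simp [hf, hg]
  · rw [sForm_sub, Complex.sub_re]
    linarith [h z]

/-- The Cauchy–Schwarz inequality for the form of a completely positive map. -/
theorem norm_sForm_sq_le (f : M →CP N) (z w : M ⊗[ℂ] K) :
    ‖sForm f.toLinearMap z w‖ ^ 2 ≤
      (sForm f.toLinearMap z z).re * (sForm f.toLinearMap w w).re := by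
  let c : PreInnerProductSpace.Core ℂ (M ⊗[ℂ] K) :=
    { inner := fun z w => sForm f.toLinearMap z w
      conj_inner_symm := fun z w => sForm_conj_symm (CompletelyPositiveMap.apply_star f) w z
      re_inner_nonneg := fun z => sForm_self_nonneg f z
      add_left := by simp
      smul_left := by simp }
  have h := InnerProductSpace.Core.inner_mul_inner_self_le (c := c) z w
  change ‖sForm f.toLinearMap z w‖ * ‖sForm f.toLinearMap w z‖ ≤ _ at h
  rw [← sForm_conj_symm (CompletelyPositiveMap.apply_star f) z w, RCLike.norm_conj, ← sq] at h
  exact h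

end Maps

/-! ### Arveson derivatives in a minimal Stinespring representation -/

section Stinespring

variable {H : Type u} [NormedAddCommGroup H] [InnerProductSpace ℂ H] [CompleteSpace H]
variable {K : Type v} [NormedAddCommGroup K] [InnerProductSpace ℂ K] [CompleteSpace K]
variable {L : Type w} [NormedAddCommGroup L] [InnerProductSpace ℂ L] [CompleteSpace L]
variable {M : VonNeumannAlgebra H} {N : VonNeumannAlgebra K}
variable {π : M →⋆ₐ[ℂ] (L →L[ℂ] L)} {V : K →L[ℂ] L}

/-- The linear map `M ⊙ K → L` sending `x ⊗ ξ` to `π(x) V ξ`. -/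
noncomputable def stinespringMap (π : M →⋆ₐ[ℂ] (L →L[ℂ] L)) (V : K →L[ℂ] L) : M ⊗[ℂ] K →ₗ[ℂ] L :=
  TensorProduct.lift <| LinearMap.mk₂ ℂ (fun x ξ => π x (V ξ))
    (by intros; simp) (by intros; simp) (by intros; simp) (by intros; simp)

@[simp]
theorem stinespringMap_tmul (x : M) (ξ : K) : stinespringMap π V (x ⊗ₜ ξ) = π x (V ξ) := by
  simp [stinespringMap]

theorem IsMinimalStinespring.denseRange {f : M →ₗ[ℂ] N} (h : IsMinimalStinespring f π V) :
    DenseRange (stinespringMap π V) := by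
  have h1 := h.dense_span
  rw [← Submodule.dense_iff_topologicalClosure_eq_top] at h1
  refine h1.mono ?_
  rw [← LinearMap.coe_range, SetLike.coe_subset_coe, Submodule.span_le]
  rintro _ ⟨x, ξ, rfl⟩
  exact ⟨x ⊗ₜ ξ, stinespringMap_tmul x ξ⟩

theorem commute_of_mem_repCommutant {T : L →L[ℂ] L} (hT : T ∈ repCommutant π) (x : M) (ζ : L) :
    π x (T ζ) = T (π x ζ) :=
  DFunLike.congr_fun (hT (π x) ⟨x, rfl⟩) ζ

theorem inner_rep_left (x : M) (ζ ω : L) : ⟪π x ζ, ω⟫_ℂ = ⟪ζ, π (star x) ω⟫_ℂ := by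
  rw [map_star]
  exact (ContinuousLinearMap.adjoint_inner_right _ _ _).symm

theorem IsArvesonDerivative.sForm_eq {f : M →ₗ[ℂ] N} {T : L →L[ℂ] L}
    (h : IsArvesonDerivative π V f T) (z w : M ⊗[ℂ] K) :
    sForm f z w = ⟪stinespringMap π V z, T (stinespringMap π V w)⟫_ℂ := by
  induction z with
  | zero => simp
  | add z₁ z₂ h₁ h₂ => simp [h₁, h₂]
  | tmul y η =>
    induction w with
    | zero => simp
    | add w₁ w₂ h₁ h₂ => simp [h₁, h₂]
    | tmul x ξ =>
      rw [sForm_tmul, h.eq_compression, stinespringMap_tmul, stinespringMap_tmul, inner_rep_left,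
        commute_of_mem_repCommutant h.mem_commutant, map_mul]
      simp [ContinuousLinearMap.adjoint_inner_right]

theorem isArvesonDerivative_of_sForm_eq {f : M →ₗ[ℂ] N} {T : L →L[ℂ] L}
    (hTc : T ∈ repCommutant π) (hpos : T.IsPositive)
    (h : ∀ z w, sForm f z w = ⟪stinespringMap π V z, T (stinespringMap π V w)⟫_ℂ) :
    IsArvesonDerivative π V f T := by
  refine ⟨hTc, hpos, fun x => ContinuousLinearMap.ext fun ξ => ext_inner_left ℂ fun η => ?_⟩
  have h1 := h (1 ⊗ₜ η) (x ⊗ₜ ξ)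
  rw [sForm_tmul, star_one, one_mul] at h1
  rw [h1]
  simp [ContinuousLinearMap.adjoint_inner_right]

theorem IsArvesonDerivative.eq_of_derivative {f g : M →ₗ[ℂ] N} {T : L →L[ℂ] L}
    (hf : IsArvesonDerivative π V f T) (hg : IsArvesonDerivative π V g T) : f = g :=
  LinearMap.ext fun x => Subtype.ext ((hf.eq_compression x).trans (hg.eq_compression x).symm)

theorem IsArvesonDerivative.map_star {f : M →ₗ[ℂ] N} {T : L →L[ℂ] L}
    (hf : IsArvesonDerivative π V f T) (x : M) : f (star x) = star (f x) := by
  refine Subtype.ext (ContinuousLinearMap.ext fun ξ => ext_inner_left ℂ fun η => ?_)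
  change _ = ⟪η, ContinuousLinearMap.adjoint ((f x : N) : K →L[ℂ] K) ξ⟫_ℂ
  rw [hf.eq_compression, ContinuousLinearMap.adjoint_inner_right, hf.eq_compression]
  simp only [ContinuousLinearMap.comp_apply]
  rw [ContinuousLinearMap.adjoint_inner_right, ← commute_of_mem_repCommutant hf.mem_commutant,
    ← inner_rep_left, ← hf.isPositive.inner_left_eq_inner_right,
    ContinuousLinearMap.adjoint_inner_left]

theorem IsArvesonDerivative.exists_completelyPositiveMap {f : M →ₗ[ℂ] N} {T : L →L[ℂ] L}
    (hf : IsArvesonDerivative π V f T) : ∃ F : M →CP N, F.toLinearMap = f :=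
  CPLebesgue.exists_completelyPositiveMap f hf.map_star fun z => by
    rw [hf.sForm_eq]
    exact hf.isPositive.re_inner_nonneg_right _

theorem IsArvesonDerivative.add {f g : M →ₗ[ℂ] N} {S T : L →L[ℂ] L}
    (hf : IsArvesonDerivative π V f S) (hg : IsArvesonDerivative π V g T) :
    IsArvesonDerivative π V (f + g) (S + T) :=
  isArvesonDerivative_of_sForm_eq (Set.add_mem_centralizer hf.mem_commutant hg.mem_commutant)
    (hf.isPositive.add hg.isPositive) fun z w => by
    simp [sForm_add, hf.sForm_eq, hg.sForm_eq]

theorem IsArvesonDerivative.natCast_smul {f : M →ₗ[ℂ] N} {T : L →L[ℂ] L}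
    (hf : IsArvesonDerivative π V f T) (n : ℕ) :
    IsArvesonDerivative π V ((n : ℂ) • f) ((n : ℂ) • T) := by
  refine isArvesonDerivative_of_sForm_eq (fun x hx => ?_)
    (hf.isPositive.smul_of_nonneg (by rw [RCLike.nonneg_iff]; simp)) fun z w => ?_
  · rw [mul_smul_comm, smul_mul_assoc, hf.mem_commutant x hx]
  · simp [sForm_smul, hf.sForm_eq]

theorem IsMinimalStinespring.arvesonDerivative_one {f : M →ₗ[ℂ] N}
    (h : IsMinimalStinespring f π V) : IsArvesonDerivative π V f 1 where
  mem_commutant := Set.one_mem_centralizer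
  isPositive := ContinuousLinearMap.isPositive_one
  eq_compression x := h.eq_compression x

/-- Operators on `L` are determined by their form on a dense range. -/
theorem eq_of_inner_denseRange {E : Type*} {J : E → L} (hJ : DenseRange J) {S T : L →L[ℂ] L}
    (h : ∀ z w, ⟪J z, S (J w)⟫_ℂ = ⟪J z, T (J w)⟫_ℂ) : S = T := by
  refine ContinuousLinearMap.coeFn_injective (hJ.equalizer S.continuous T.continuous ?_)
  funext w
  refine ext_inner_left ℂ fun v => ?_
  have hS : Continuous fun v => ⟪v, S (J w)⟫_ℂ := by fun_prop
  have hT : Continuous fun v => ⟪v, T (J w)⟫_ℂ := by fun_prop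
  exact congrFun (hJ.equalizer hS hT (funext fun z => h z w)) v

/-- A bounded sesquilinear form is represented by an operator. -/
theorem exists_operator_of_form {E : Type*} [AddCommGroup E] [Module ℂ E] {J : E →ₗ[ℂ] L}
    (hJ : DenseRange J) (s : E →ₗ⋆[ℂ] E →ₗ[ℂ] ℂ) (C : ℝ) (hs : ∀ z w, ‖s z w‖ ≤ C * ‖J z‖ * ‖J w‖) :
    ∃ T : L →L[ℂ] L, ∀ z w, s z w = ⟪J z, T (J w)⟫_ℂ := by
  let φ : E → (L →L[ℂ] ℂ) := fun z => (s z).extendOfNorm J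
  have hφ : ∀ z w, φ z (J w) = s z w := fun z w =>
    LinearMap.extendOfNorm_eq hJ ⟨C * ‖J z‖, hs z⟩ w
  have hφ' : ∀ z (g : L →L[ℂ] ℂ), (∀ w, g (J w) = s z w) → φ z = g := fun z g hg =>
    ContinuousLinearMap.coeFn_injective (hJ.equalizer (φ z).continuous g.continuous
      (funext fun w => (hφ z w).trans (hg w).symm))
  -- The Riesz vector of `s z`. Both `s` and the Riesz map are conjugate-linear, so `Ag` is linear;
  -- the operator sought is the adjoint of its extension along `J`.
  let Ag : E →ₗ[ℂ] L :=
    { toFun := fun z => (InnerProductSpace.toDual ℂ L).symm (φ z)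
      map_add' := fun z w => by
        rw [hφ' (z + w) (φ z + φ w) (by simp [hφ]), map_add]
      map_smul' := fun c z => by
        rw [hφ' (c • z) (starRingEnd ℂ c • φ z) (by simp [hφ]), map_smulₛₗ]
        simp }
  have hAg : ∀ z, ‖Ag z‖ ≤ |C| * ‖J z‖ := fun z => by
    change ‖(InnerProductSpace.toDual ℂ L).symm (φ z)‖ ≤ _
    rw [LinearIsometryEquiv.norm_map]
    refine LinearMap.opNorm_extendOfNorm_le hJ (by positivity) fun w => (hs z w).trans ?_
    gcongr
    exact le_abs_self C
  refine ⟨ContinuousLinearMap.adjoint (Ag.extendOfNorm J), fun z w => ?_⟩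
  rw [ContinuousLinearMap.adjoint_inner_right, LinearMap.extendOfNorm_eq hJ ⟨_, hAg⟩]
  change _ = ⟪(InnerProductSpace.toDual ℂ L).symm (φ z), _⟫_ℂ
  rw [InnerProductSpace.toDual_symm_apply, hφ]

variable {Γ : M →ₗ[ℂ] N}

theorem IsMinimalStinespring.arvesonDerivative_unique (hV : IsMinimalStinespring Γ π V)
    {f : M →ₗ[ℂ] N} {S T : L →L[ℂ] L} (hS : IsArvesonDerivative π V f S)
    (hT : IsArvesonDerivative π V f T) : S = T :=
  eq_of_inner_denseRange hV.denseRange fun z w => by rw [← hS.sForm_eq, ← hT.sForm_eq]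

theorem isPositive_of_denseRange {E : Type*} {J : E → L} (hJ : DenseRange J) {T : L →L[ℂ] L}
    (h : ∀ z, 0 ≤ (⟪J z, T (J z)⟫_ℂ).re) (hT : IsSelfAdjoint T) : T.IsPositive := by
  rw [ContinuousLinearMap.isPositive_def']
  refine ⟨hT, fun ζ => ?_⟩
  refine hJ.induction_on ζ (isClosed_le continuous_const ?_) fun z => ?_
  · exact T.reApplyInnerSelf_continuous
  · rw [ContinuousLinearMap.reApplyInnerSelf_apply, inner_re_symm]
    exact h z

/-- This symmetry of the form is what puts the operator representing it in `π(M)'`. -/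
theorem sForm_mul_left (f : M →ₗ[ℂ] N) (a : M) (z w : M ⊗[ℂ] K) :
    sForm f ((LinearMap.mulLeft ℂ (star a)).rTensor K z) w =
      sForm f z ((LinearMap.mulLeft ℂ a).rTensor K w) := by
  induction z with
  | zero => simp
  | add z₁ z₂ h₁ h₂ => simp [h₁, h₂]
  | tmul y η =>
    induction w with
    | zero => simp
    | add w₁ w₂ h₁ h₂ => simp only [map_add, h₁, h₂]
    | tmul x ξ => simp [sForm_tmul, mul_assoc]

theorem stinespringMap_mul_left (a : M) (z : M ⊗[ℂ] K) :
    stinespringMap π V ((LinearMap.mulLeft ℂ a).rTensor K z) = π a (stinespringMap π V z) := by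
  induction z with
  | zero => simp
  | add z₁ z₂ h₁ h₂ => simp [h₁, h₂]
  | tmul y η => simp

/-- Arveson's Radon–Nikodym theorem. -/
theorem IsMinimalStinespring.exists_arvesonDerivative (hV : IsMinimalStinespring Γ π V)
    (F : M →CP N) (C : ℝ)
    (h : ∀ z : M ⊗[ℂ] K, (sForm F.toLinearMap z z).re ≤ C * (sForm Γ z z).re) :
    ∃ T, IsArvesonDerivative π V F.toLinearMap T := by
  set J := stinespringMap π V with hJdef
  have hJ : DenseRange J := hV.denseRange
  have hΓ : ∀ z, (sForm Γ z z).re = ‖J z‖ ^ 2 := fun z => by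
    rw [hV.arvesonDerivative_one.sForm_eq]
    exact inner_self_eq_norm_sq (𝕜 := ℂ) _
  have hbound : ∀ z w, ‖sForm F.toLinearMap z w‖ ≤ |C| * ‖J z‖ * ‖J w‖ := fun z w => by
    refine abs_le_of_sq_le_sq' ?_ (by positivity) |>.2
    have h' : ∀ z, (sForm F.toLinearMap z z).re ≤ |C| * ‖J z‖ ^ 2 := fun z =>
      (h z).trans (by rw [hΓ]; gcongr; exact le_abs_self C)
    calc _ ≤ _ := norm_sForm_sq_le F z w
      _ ≤ (|C| * ‖J z‖ ^ 2) * (|C| * ‖J w‖ ^ 2) :=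
        mul_le_mul (h' z) (h' w) (sForm_self_nonneg F w) (by positivity)
      _ = _ := by ring
  obtain ⟨T, hT⟩ := exists_operator_of_form hJ (sForm F.toLinearMap) |C| hbound
  have hTsa : IsSelfAdjoint T := by
    refine eq_of_inner_denseRange hJ fun z w => ?_
    rw [ContinuousLinearMap.star_eq_adjoint, ContinuousLinearMap.adjoint_inner_right, ← hT,
      ← inner_conj_symm, ← hT, sForm_conj_symm (CompletelyPositiveMap.apply_star F)]
  have hTc : T ∈ repCommutant π := by
    rintro _ ⟨a, rfl⟩
    refine eq_of_inner_denseRange hJ fun z w => ?_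
    have h1 := inner_rep_left (π := π) (star a) (J z) (T (J w))
    rw [star_star] at h1
    rw [mul_apply_eq_comp, mul_apply_eq_comp, ← h1, hJdef,
      ← stinespringMap_mul_left, ← stinespringMap_mul_left, ← hJdef, ← hT, ← hT, sForm_mul_left]
  refine ⟨T, isArvesonDerivative_of_sForm_eq hTc
    (isPositive_of_denseRange hJ (fun z => ?_) hTsa) hT⟩
  rw [← hT]
  exact sForm_self_nonneg F z

end Stinespring

/-! ### Unitaries of `N'` and which operators yield maps into `N` -/

section Equivariance

variable {H : Type u} [NormedAddCommGroup H] [InnerProductSpace ℂ H] [CompleteSpace H]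
variable {K : Type v} [NormedAddCommGroup K] [InnerProductSpace ℂ K] [CompleteSpace K]
variable {L : Type w} [NormedAddCommGroup L] [InnerProductSpace ℂ L] [CompleteSpace L]
variable {M : VonNeumannAlgebra H} {N : VonNeumannAlgebra K}
variable {π : M →⋆ₐ[ℂ] (L →L[ℂ] L)} {V : K →L[ℂ] L} {Γ : M →ₗ[ℂ] N}

/-- `W` implements the operator `u` of `K` on `L`: `W π(x) V = π(x) V u`. -/
def Implements (π : M →⋆ₐ[ℂ] (L →L[ℂ] L)) (V : K →L[ℂ] L) (u : K →L[ℂ] K) (W : L →L[ℂ] L) : Prop :=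
  ∀ x ξ, W (π x (V ξ)) = π x (V (u ξ))

theorem Implements.apply_stinespringMap {u : K →L[ℂ] K} {W : L →L[ℂ] L} (h : Implements π V u W)
    (z : M ⊗[ℂ] K) :
    W (stinespringMap π V z) = stinespringMap π V ((u : K →ₗ[ℂ] K).lTensor M z) := by
  induction z with
  | zero => simp
  | add z₁ z₂ h₁ h₂ => simp only [map_add, h₁, h₂]
  | tmul y η => simp [h y η]

theorem sForm_unitary (f : M →ₗ[ℂ] N) {u : K →L[ℂ] K} (hu : u ∈ unitary (K →L[ℂ] K))
    (huN : u ∈ N.commutant) (z w : M ⊗[ℂ] K) :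
    sForm f ((u : K →ₗ[ℂ] K).lTensor M z) ((u : K →ₗ[ℂ] K).lTensor M w) = sForm f z w := by
  induction z with
  | zero => simp
  | add z₁ z₂ h₁ h₂ => simp only [map_add, LinearMap.add_apply, h₁, h₂]
  | tmul y η =>
    induction w with
    | zero => simp
    | add w₁ w₂ h₁ h₂ => simp only [map_add, h₁, h₂]
    | tmul x ξ =>
      rw [LinearMap.lTensor_tmul, LinearMap.lTensor_tmul, sForm_tmul, sForm_tmul]
      have h1 := VonNeumannAlgebra.mem_commutant_iff.mp huN _ (f (star y * x)).2
      have h2 : ((f (star y * x) : N) : K →L[ℂ] K) (u ξ) =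
        u (((f (star y * x) : N) : K →L[ℂ] K) ξ) := DFunLike.congr_fun h1 ξ
      have h3 : ContinuousLinearMap.adjoint u * u = 1 := (Unitary.mem_iff.mp hu).1
      rw [ContinuousLinearMap.coe_coe, h2, ← ContinuousLinearMap.adjoint_inner_right,
        ← mul_apply_eq_comp, h3, one_apply_eq_self]

/-- Since `Γ` takes values in `N`, the map `1 ⊗ u` preserves its form, hence is isometric for the
seminorm `‖stinespringMap π V z‖` and extends to `L`. -/
theorem IsMinimalStinespring.exists_implements (hV : IsMinimalStinespring Γ π V) {u : K →L[ℂ] K}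
    (hu : u ∈ unitary (K →L[ℂ] K)) (huN : u ∈ N.commutant) : ∃ W, Implements π V u W := by
  let g : M ⊗[ℂ] K →ₗ[ℂ] L := stinespringMap π V ∘ₗ (u : K →ₗ[ℂ] K).lTensor M
  have hg : ∀ z, ‖g z‖ ≤ 1 * ‖stinespringMap π V z‖ := fun z => by
    have h := sForm_unitary Γ hu huN z z
    rw [hV.arvesonDerivative_one.sForm_eq, hV.arvesonDerivative_one.sForm_eq,
      one_apply_eq_self, one_apply_eq_self, inner_self_eq_norm_sq_to_K,
      inner_self_eq_norm_sq_to_K] at h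
    have h' : ‖g z‖ ^ 2 = ‖stinespringMap π V z‖ ^ 2 := by exact_mod_cast h
    rw [one_mul]
    exact ((sq_eq_sq₀ (norm_nonneg _) (norm_nonneg _)).mp h').le
  refine ⟨g.extendOfNorm (stinespringMap π V), fun x ξ => ?_⟩
  have := LinearMap.extendOfNorm_eq hV.denseRange ⟨1, hg⟩ (x ⊗ₜ ξ)
  simpa [g] using this

/-- Invariance of `s_f` under `1 ⊗ u`, read on the dense range; the case `T = 1` says that `W` is
isometric. -/
theorem Implements.conj_eq (hV : IsMinimalStinespring Γ π V) {f : M →ₗ[ℂ] N} {T W : L →L[ℂ] L}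
    (hT : IsArvesonDerivative π V f T) {u : K →L[ℂ] K}
    (hu : u ∈ unitary (K →L[ℂ] K)) (huN : u ∈ N.commutant) (hW : Implements π V u W) :
    star W * (T * W) = T := by
  refine eq_of_inner_denseRange hV.denseRange fun z w => ?_
  rw [mul_apply_eq_comp, mul_apply_eq_comp, ContinuousLinearMap.star_eq_adjoint,
    ContinuousLinearMap.adjoint_inner_right, hW.apply_stinespringMap, hW.apply_stinespringMap,
    ← hT.sForm_eq, ← hT.sForm_eq, sForm_unitary f hu huN]

theorem Implements.mul_eq_one (hV : IsMinimalStinespring Γ π V) {u u' : K →L[ℂ] K}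
    {W W' : L →L[ℂ] L} (hW : Implements π V u W) (hW' : Implements π V u' W') (h : u * u' = 1) :
    W * W' = 1 := by
  refine eq_of_inner_denseRange hV.denseRange fun z w => ?_
  rw [mul_apply_eq_comp, hW'.apply_stinespringMap, hW.apply_stinespringMap,
    ← LinearMap.comp_apply (LinearMap.lTensor _ _), ← LinearMap.lTensor_comp,
    ← ContinuousLinearMap.toLinearMap_comp, ← ContinuousLinearMap.mul_def, h]
  simp [ContinuousLinearMap.one_def]

/-- The implementers of unitaries in the commutant of `N`. -/
def implementers (N : VonNeumannAlgebra K) (π : M →⋆ₐ[ℂ] (L →L[ℂ] L)) (V : K →L[ℂ] L) :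
    Set (L →L[ℂ] L) :=
  {W | ∃ u ∈ unitary (K →L[ℂ] K), u ∈ N.commutant ∧ Implements π V u W}

/-- The operators commuting with `π(M)` and with the implementers of unitaries in `N'`. -/
def derivativeAlgebra (N : VonNeumannAlgebra K) (π : M →⋆ₐ[ℂ] (L →L[ℂ] L)) (V : K →L[ℂ] L) :
    Set (L →L[ℂ] L) :=
  Set.centralizer (Set.range π ∪ implementers N π V)

/-- An implementer of `u⋆` is a right inverse of `W`, and `W⋆` is a left inverse, so the two agree.
Thus `W` is unitary and the generating set is closed under adjoints. -/
theorem Implements.star_implements (hV : IsMinimalStinespring Γ π V) {u : K →L[ℂ] K}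
    (hu : u ∈ unitary (K →L[ℂ] K)) (huN : u ∈ N.commutant) {W : L →L[ℂ] L}
    (hW : Implements π V u W) : Implements π V (star u) (star W) ∧ W * star W = 1 := by
  have hu' : star u ∈ unitary (K →L[ℂ] K) := Unitary.star_mem hu
  obtain ⟨W', hW'⟩ := hV.exists_implements hu' (star_mem huN)
  have h1 : W * W' = 1 := hW.mul_eq_one hV hW' (Unitary.mem_iff.mp hu).2
  have h2 : star W * W = 1 := by
    simpa using hW.conj_eq hV hV.arvesonDerivative_one hu huN
  have h3 : star W = W' := left_inv_eq_right_inv h2 h1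
  rw [h3]
  exact ⟨hW', h1⟩

theorem star_mem_generators (hV : IsMinimalStinespring Γ π V) {S : L →L[ℂ] L}
    (hS : S ∈ Set.range π ∪ implementers N π V) : star S ∈ Set.range π ∪ implementers N π V := by
  rcases hS with ⟨x, rfl⟩ | ⟨u, hu, huN, hW⟩
  · exact Or.inl ⟨star x, map_star π x⟩
  · exact Or.inr ⟨star u, Unitary.star_mem hu, star_mem huN, (hW.star_implements hV hu huN).1⟩

theorem IsArvesonDerivative.mem_derivativeAlgebra (hV : IsMinimalStinespring Γ π V)
    {f : M →ₗ[ℂ] N} {T : L →L[ℂ] L} (hT : IsArvesonDerivative π V f T) :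
    T ∈ derivativeAlgebra N π V := by
  rintro S (hS | ⟨u, hu, huN, hW⟩)
  · exact hT.mem_commutant S hS
  · have h1 := hW.conj_eq hV hT hu huN
    have h2 := (hW.star_implements hV hu huN).2
    calc S * T = S * (star S * (T * S)) := by rw [h1]
      _ = T * S := by rw [← mul_assoc, h2, one_mul]

theorem derivativeAlgebra_subset : derivativeAlgebra N π V ⊆ repCommutant π :=
  Set.centralizer_subset Set.subset_union_left

/-- By the double commutant theorem it is enough to commute with `N'`, which is spanned by its
unitaries; for a unitary `u`, its implementer carries `u` past `V⋆ T π(x) V`. -/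
theorem compression_mem (hV : IsMinimalStinespring Γ π V) {T : L →L[ℂ] L}
    (hT : T ∈ derivativeAlgebra N π V) (x : M) :
    ContinuousLinearMap.adjoint V ∘L T ∘L π x ∘L V ∈ N := by
  set Y := ContinuousLinearMap.adjoint V ∘L T ∘L π x ∘L V with hY
  have hunit : ∀ u ∈ unitary (K →L[ℂ] K), u ∈ N.commutant → u * Y = Y * u := by
    intro u hu huN
    obtain ⟨W, hW⟩ := hV.exists_implements hu huN
    have hTW : W * T = T * W := hT W (Or.inr ⟨u, hu, huN, hW⟩)
    refine ContinuousLinearMap.ext fun ξ => ext_inner_left ℂ fun η => ?_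
    have h1 := (hW.star_implements hV hu huN).1 1 η
    rw [map_one, one_apply_eq_self, one_apply_eq_self] at h1
    have h2 : W (T (π x (V ξ))) = T (π x (V (u ξ))) := by
      rw [← hW x ξ]; exact DFunLike.congr_fun hTW _
    simp only [mul_apply_eq_comp, hY, ContinuousLinearMap.comp_apply]
    rw [← h2, ContinuousLinearMap.adjoint_inner_right, ← ContinuousLinearMap.adjoint_inner_left,
      ContinuousLinearMap.adjoint_inner_right, ← ContinuousLinearMap.star_eq_adjoint, ← h1,
      ContinuousLinearMap.star_eq_adjoint, ContinuousLinearMap.adjoint_inner_left]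
  rw [← VonNeumannAlgebra.commutant_commutant N, VonNeumannAlgebra.mem_commutant_iff]
  intro a ha
  obtain ⟨u, c, hac, -⟩ := CStarAlgebra.exists_sum_four_unitary (⟨a, ha⟩ : N.commutant)
  have hac' : a = ∑ i, c i • ((u i : N.commutant) : K →L[ℂ] K) := by
    have := congrArg Subtype.val hac
    simpa using this
  rw [hac', Finset.sum_mul, Finset.mul_sum]
  refine Finset.sum_congr rfl fun i _ => ?_
  rw [smul_mul_assoc, mul_smul_comm, hunit _ ?_ (u i).1.2]
  have := (u i).2
  rw [Unitary.mem_iff] at this ⊢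
  exact ⟨congrArg Subtype.val this.1, congrArg Subtype.val this.2⟩

/-- A positive operator commuting with `π(M)` and the implementers is the Arveson derivative of a
completely positive map into `N`. -/
theorem exists_of_mem_derivativeAlgebra (hV : IsMinimalStinespring Γ π V) {T : L →L[ℂ] L}
    (hT : T ∈ derivativeAlgebra N π V) (hpos : T.IsPositive) :
    ∃ F : M →CP N, IsArvesonDerivative π V F.toLinearMap T := by
  let f : M →ₗ[ℂ] N :=
    { toFun := fun x => ⟨ContinuousLinearMap.adjoint V ∘L T ∘L π x ∘L V, compression_mem hV hT x⟩
      map_add' := fun x y => Subtype.ext (ContinuousLinearMap.ext fun ξ => by simp)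
      map_smul' := fun c x => Subtype.ext (ContinuousLinearMap.ext fun ξ => by simp) }
  have hf : IsArvesonDerivative π V f T := ⟨derivativeAlgebra_subset hT, hpos, fun x => rfl⟩
  obtain ⟨F, hF⟩ := hf.exists_completelyPositiveMap
  exact ⟨F, hF.symm ▸ hf⟩

theorem le_of_denseRange {E : Type*} {J : E → L} (hJ : DenseRange J) {S T : L →L[ℂ] L}
    (hS : IsSelfAdjoint S) (hT : IsSelfAdjoint T)
    (h : ∀ z, (⟪J z, S (J z)⟫_ℂ).re ≤ (⟪J z, T (J z)⟫_ℂ).re) : S ≤ T :=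
  (ContinuousLinearMap.le_def _ _).mpr <|
    isPositive_of_denseRange hJ (fun z => by simpa [inner_sub_right] using h z) (hT.sub hS)

theorem re_inner_le_of_le {S T : L →L[ℂ] L} (h : S ≤ T) (ζ : L) :
    (⟪ζ, S ζ⟫_ℂ).re ≤ (⟪ζ, T ζ⟫_ℂ).re := by
  have := ((ContinuousLinearMap.le_def _ _).mp h).re_inner_nonneg_right ζ
  simpa [inner_sub_right] using this

theorem IsMinimalStinespring.le_of_sForm_le (hV : IsMinimalStinespring Γ π V) {f g : M →ₗ[ℂ] N}
    {S T : L →L[ℂ] L} (hS : IsArvesonDerivative π V f S) (hT : IsArvesonDerivative π V g T)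
    (h : ∀ z : M ⊗[ℂ] K, (sForm f z z).re ≤ (sForm g z z).re) : S ≤ T :=
  le_of_denseRange hV.denseRange hS.isPositive.isSelfAdjoint hT.isPositive.isSelfAdjoint
    fun z => by rw [← hS.sForm_eq, ← hT.sForm_eq]; exact h z

theorem cpLe_of_le {f g : M →ₗ[ℂ] N} {S T : L →L[ℂ] L} (hS : IsArvesonDerivative π V f S)
    (hT : IsArvesonDerivative π V g T) (h : S ≤ T) : CPLe f g :=
  cpLe_of_sForm_le hS.map_star hT.map_star fun z => by
    rw [hS.sForm_eq, hT.sForm_eq]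
    exact re_inner_le_of_le h _

/-- Completely positive maps with the same quadratic form have the same derivative. -/
theorem IsMinimalStinespring.derivative_of_sForm_self_eq (hV : IsMinimalStinespring Γ π V)
    {f : M →ₗ[ℂ] N} {T : L →L[ℂ] L} (hT : IsArvesonDerivative π V f T) (F : M →CP N)
    (h : ∀ z : M ⊗[ℂ] K, (sForm F.toLinearMap z z).re = (sForm f z z).re) :
    IsArvesonDerivative π V F.toLinearMap T := by
  -- The form of `T` is at most `‖T‖` times that of `Γ`, so `F` has a derivative `S`; comparing
  -- quadratic forms both ways gives `S = T`.
  obtain ⟨S, hS⟩ := hV.exists_arvesonDerivative F ‖T‖ fun z => by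
    rw [h, hT.sForm_eq, hV.arvesonDerivative_one.sForm_eq, one_apply_eq_self]
    refine (Complex.re_le_norm _).trans ((norm_inner_le_norm _ _).trans ?_)
    have h1 := inner_self_eq_norm_sq (𝕜 := ℂ) (stinespringMap π V z)
    rw [RCLike.re_eq_complex_re] at h1
    rw [h1]
    nlinarith [T.le_opNorm (stinespringMap π V z), norm_nonneg (stinespringMap π V z)]
  have : S = T := le_antisymm (hV.le_of_sForm_le hS hT fun z => (h z).le)
    (hV.le_of_sForm_le hT hS fun z => (h z).ge)
  exact this ▸ hS

end Equivariance

/-! ### Resolvents, support projections and the operator parallel sum -/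

section Operators

variable {L : Type w} [NormedAddCommGroup L] [InnerProductSpace ℂ L] [CompleteSpace L]
variable {A B : L →L[ℂ] L}

/-- The resolvent `(1 + m A)⁻¹`. -/
noncomputable def resolventInv (A : L →L[ℂ] L) (m : ℕ) : L →L[ℂ] L :=
  Ring.inverse (1 + (m : ℂ) • A)

theorem natCast_smul_nonneg (hA : 0 ≤ A) (m : ℕ) : 0 ≤ (m : ℂ) • A := by
  rw [ContinuousLinearMap.nonneg_iff_isPositive] at hA ⊢
  exact hA.smul_of_nonneg (by rw [RCLike.nonneg_iff]; simp)

theorem isUnit_one_add_smul (hA : 0 ≤ A) (m : ℕ) : IsUnit (1 + (m : ℂ) • A) :=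
  CStarAlgebra.isUnit_of_le 1 (le_add_of_nonneg_right (natCast_smul_nonneg hA m))
    isStrictlyPositive_one

theorem mul_resolventInv (hA : 0 ≤ A) (m : ℕ) : (1 + (m : ℂ) • A) * resolventInv A m = 1 :=
  Ring.mul_inverse_cancel _ (isUnit_one_add_smul hA m)

theorem resolventInv_mul (hA : 0 ≤ A) (m : ℕ) : resolventInv A m * (1 + (m : ℂ) • A) = 1 :=
  Ring.inverse_mul_cancel _ (isUnit_one_add_smul hA m)

theorem commute_resolventInv {S : L →L[ℂ] L} (h : Commute S A) (m : ℕ) :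
    Commute S (resolventInv A m) := by
  have hD : Commute S (1 + (m : ℂ) • A) := (Commute.one_right S).add_right (h.smul_right _)
  rw [resolventInv]
  by_cases hu : IsUnit (1 + (m : ℂ) • A)
  · obtain ⟨U, hU⟩ := hu
    rw [← hU] at hD ⊢
    rw [Ring.inverse_unit]
    exact hD.units_inv_right
  -- `Ring.inverse` is zero off the units, so no positivity of `A` is required.
  · rw [Ring.inverse_non_unit _ hu]
    exact Commute.zero_right S

theorem resolventInv_nonneg (hA : 0 ≤ A) (m : ℕ) : 0 ≤ resolventInv A m := by
  have hD : 0 ≤ 1 + (m : ℂ) • A := add_nonneg zero_le_one (natCast_smul_nonneg hA m)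
  have hs : IsSelfAdjoint (resolventInv A m) := by
    have := congrArg star (mul_resolventInv hA m)
    rw [star_mul, hD.isSelfAdjoint.star_eq, star_one] at this
    exact left_inv_eq_right_inv this (mul_resolventInv hA m)
  have h := star_left_conjugate_nonneg hD (resolventInv A m)
  rwa [hs.star_eq, resolventInv_mul hA, one_mul] at h

theorem one_sub_resolventInv (hA : 0 ≤ A) (m : ℕ) :
    1 - resolventInv A m = (m : ℂ) • (A * resolventInv A m) := by
  conv_lhs => rw [← mul_resolventInv hA m]
  simp [add_mul]

theorem resolventInv_le_one (hA : 0 ≤ A) (m : ℕ) : resolventInv A m ≤ 1 := by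
  rw [← sub_nonneg, one_sub_resolventInv hA]
  exact natCast_smul_nonneg
    ((commute_resolventInv (Commute.refl A) m).mul_nonneg hA (resolventInv_nonneg hA m)) m

theorem norm_resolventInv_apply_le (hA : 0 ≤ A) (m : ℕ) (ζ : L) :
    ‖resolventInv A m ζ‖ ≤ ‖ζ‖ := by
  have h : ‖resolventInv A m‖ ≤ 1 :=
    (CStarAlgebra.norm_le_one_iff_of_nonneg _ (resolventInv_nonneg hA m)).mpr
      (resolventInv_le_one hA m)
  exact (resolventInv A m).le_of_opNorm_le h ζ |>.trans (by rw [one_mul])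

theorem resolventInv_sub (hA : 0 ≤ A) (m : ℕ) :
    resolventInv A m - resolventInv A (m + 1) = resolventInv A m * A * resolventInv A (m + 1) := by
  have h : A = (1 + ((m + 1 : ℕ) : ℂ) • A) - (1 + (m : ℂ) • A) := by
    push_cast
    rw [add_smul, one_smul]
    abel
  calc _ = resolventInv A m * ((1 + ((m + 1 : ℕ) : ℂ) • A) * resolventInv A (m + 1)) -
        resolventInv A m * (1 + (m : ℂ) • A) * resolventInv A (m + 1) := by
        rw [mul_resolventInv hA, resolventInv_mul hA, mul_one, one_mul]
    _ = resolventInv A m * ((1 + ((m + 1 : ℕ) : ℂ) • A) - (1 + (m : ℂ) • A)) *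
        resolventInv A (m + 1) := by
        rw [mul_sub, sub_mul, mul_assoc, mul_assoc]
    _ = _ := by rw [← h]

/-- The derivative of the parallel sum `n Φ : Ψ`. -/
noncomputable def parallelDerivative (A B : L →L[ℂ] L) : ℕ → (L →L[ℂ] L)
  | 0 => 0
  | m + 1 => B - B * resolventInv A m * B

/-- With `B = 1 - A` one has `1 - B R = (m + 1) A R` for the resolvent `R`. The derivative becomes a
multiple of a product of commuting positive operators, which makes positivity and the bound by `n A`
visible. -/
theorem parallelDerivative_succ_eq (hA : 0 ≤ A) (hAB : A + B = 1) (m : ℕ) :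
    parallelDerivative A B (m + 1) = ((m + 1 : ℕ) : ℂ) • (A * resolventInv A m * B) := by
  have hB : B = 1 - A := eq_sub_of_add_eq' hAB
  have hAR := commute_resolventInv (Commute.refl A) m
  have h1 : 1 - B * resolventInv A m = ((m + 1 : ℕ) : ℂ) • (A * resolventInv A m) := by
    rw [hB, sub_mul, one_mul, ← sub_add, one_sub_resolventInv hA]
    push_cast
    rw [add_smul, one_smul]
  calc _ = (1 - B * resolventInv A m) * B := by rw [sub_mul, one_mul]; rfl
    _ = _ := by rw [h1, smul_mul_assoc]

theorem commute_parallelDerivative {S : L →L[ℂ] L} (hSA : Commute S A) (hSB : Commute S B) (n : ℕ) :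
    Commute S (parallelDerivative A B n) := by
  cases n with
  | zero => exact Commute.zero_right S
  | succ m => exact hSB.sub_right ((hSB.mul_right (commute_resolventInv hSA m)).mul_right hSB)

theorem commute_of_add_eq_one (hAB : A + B = 1) : Commute A B := by
  rw [eq_sub_of_add_eq' hAB]
  exact (Commute.one_right A).sub_right (Commute.refl A)

theorem parallelDerivative_nonneg (hA : 0 ≤ A) (hB : 0 ≤ B) (hAB : A + B = 1) (n : ℕ) :
    0 ≤ parallelDerivative A B n := by
  cases n with
  | zero => exact le_rfl
  | succ m =>
    rw [parallelDerivative_succ_eq hA hAB]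
    have h := commute_of_add_eq_one hAB
    refine natCast_smul_nonneg (Commute.mul_nonneg ((commute_resolventInv (Commute.refl A)
      m).mul_nonneg hA (resolventInv_nonneg hA m)) hB ?_) _
    exact h.mul_left (commute_resolventInv h.symm m).symm

theorem parallelDerivative_mono (hA : 0 ≤ A) (hB : 0 ≤ B) (hAB : A + B = 1) (n : ℕ) :
    parallelDerivative A B n ≤ parallelDerivative A B (n + 1) := by
  cases n with
  | zero => exact parallelDerivative_nonneg hA hB hAB 1
  | succ m =>
    have hR := commute_resolventInv (Commute.refl A)
    rw [← sub_nonneg]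
    -- The resolvent identity writes the increment as a conjugate by `B` of a product of commuting
    -- positive operators.
    have h : parallelDerivative A B (m + 1 + 1) - parallelDerivative A B (m + 1) =
        B * (resolventInv A m * A * resolventInv A (m + 1)) * B := by
      rw [← resolventInv_sub hA]
      simp only [parallelDerivative]
      noncomm_ring
    rw [h]
    refine hB.isSelfAdjoint.conjugate_nonneg ?_
    refine Commute.mul_nonneg ((hR m).symm.mul_nonneg (resolventInv_nonneg hA m) hA)
      (resolventInv_nonneg hA _) ?_
    exact (commute_resolventInv (hR m).symm (m + 1)).mul_left (hR (m + 1))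

theorem parallelDerivative_le (hA : 0 ≤ A) (hAB : A + B = 1) (n : ℕ) :
    parallelDerivative A B n ≤ (n : ℂ) • A := by
  cases n with
  | zero => simp [parallelDerivative]
  | succ m =>
    have hR := commute_resolventInv (Commute.refl A) m
    have h2 : A - A * resolventInv A m * B = ((m + 1 : ℕ) : ℂ) • (A * (A * resolventInv A m)) := by
      have hB : B = 1 - A := eq_sub_of_add_eq' hAB
      have h3 := one_sub_resolventInv hA m
      push_cast
      rw [add_smul, one_smul, ← mul_smul_comm, ← h3, hB, mul_assoc A (resolventInv A m), mul_sub,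
        mul_one, ← hR.eq]
      noncomm_ring
    rw [← sub_nonneg, parallelDerivative_succ_eq hA hAB, ← smul_sub, h2]
    exact natCast_smul_nonneg (natCast_smul_nonneg
      (((Commute.refl A).mul_right hR).mul_nonneg hA
        (hR.mul_nonneg hA (resolventInv_nonneg hA m))) _) _

/-- Completing the square. -/
theorem re_inner_add_re_inner (hA : IsSelfAdjoint A) (hB : IsSelfAdjoint B) {q w : L}
    (hq : A q + B q = B w) (v : L) :
    (⟪v + q, A (v + q)⟫_ℂ).re + (⟪w - (v + q), B (w - (v + q))⟫_ℂ).re =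
      (⟪v, A v⟫_ℂ).re + (⟪v, B v⟫_ℂ).re + (⟪w, B w - B q⟫_ℂ).re := by
  have hs : ∀ {S : L →L[ℂ] L}, IsSelfAdjoint S → ∀ x y, (⟪x, S y⟫_ℂ).re = (⟪y, S x⟫_ℂ).re := by
    intro S hS x y
    have h : ⟪x, S y⟫_ℂ = ⟪S x, y⟫_ℂ := by
      conv_lhs => rw [← hS.star_eq]
      exact ContinuousLinearMap.adjoint_inner_right _ _ _
    rw [h, ← inner_conj_symm, Complex.conj_re]
  have h1 := congrArg (fun x => (⟪v, x⟫_ℂ).re) hq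
  have h2 := congrArg (fun x => (⟪q, x⟫_ℂ).re) hq
  simp only [inner_add_right, Complex.add_re] at h1 h2
  simp only [map_add, map_sub, inner_add_left, inner_add_right, inner_sub_left, inner_sub_right,
    Complex.add_re, Complex.sub_re]
  linarith [hs hA q v, hs hB q v, hs hB w v, hs hB w q]

theorem mem_closedRange (T : L →L[ℂ] L) (ζ : L) : T ζ ∈ closedRange T :=
  Submodule.le_topologicalClosure _ ⟨ζ, rfl⟩

theorem closedRange_orthogonal {T : L →L[ℂ] L} (hT : IsSelfAdjoint T) (ζ : L) :
    ζ ∈ (closedRange T)ᗮ ↔ T ζ = 0 := by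
  rw [closedRange, Submodule.orthogonal_closure, ContinuousLinearMap.IsStarNormal.orthogonal_range hT.isStarNormal]
  exact LinearMap.mem_ker

theorem apply_sub_supportProj {T : L →L[ℂ] L} (hT : IsSelfAdjoint T) (ζ : L) :
    T (ζ - supportProj T ζ) = 0 :=
  (closedRange_orthogonal hT _).mp (Submodule.sub_starProjection_mem_orthogonal ζ)

theorem supportProj_mul_self (T : L →L[ℂ] L) : supportProj T * T = T := by
  refine ContinuousLinearMap.ext fun ζ => ?_
  exact Submodule.starProjection_eq_self_iff.mpr (mem_closedRange T ζ)

theorem supportProj_isSelfAdjoint (T : L →L[ℂ] L) : IsSelfAdjoint (supportProj T) :=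
  isSelfAdjoint_starProjection _

theorem mul_supportProj_self {T : L →L[ℂ] L} (hT : IsSelfAdjoint T) : T * supportProj T = T := by
  have := congrArg star (supportProj_mul_self T)
  rwa [star_mul, hT.star_eq, (supportProj_isSelfAdjoint T).star_eq] at this

/-- An operator commuting, along with its adjoint, with a self-adjoint operator, commutes with its
support projection. -/
theorem commute_supportProj {S T : L →L[ℂ] L} (h : Commute S T) (h' : Commute (star S) T) :
    Commute S (supportProj T) := by
  have key : ∀ {S : L →L[ℂ] L}, Commute S T → supportProj T * (S * supportProj T) =
      S * supportProj T := by
    intro S h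
    refine ContinuousLinearMap.ext fun ζ => ?_
    refine Submodule.starProjection_eq_self_iff.mpr ?_
    have hζ : supportProj T ζ ∈ closedRange T := Submodule.starProjection_apply_mem _ _
    -- `S` leaves the range of `T` invariant, hence its closure. Applied to `S` and to `S⋆`, this
    -- makes the closure reducing.
    have : closedRange T ≤ (closedRange T).comap (S : L →ₗ[ℂ] L) := by
      refine Submodule.topologicalClosure_minimal _ ?_ ?_
      · rintro _ ⟨ω, rfl⟩
        have : S (T ω) = T (S ω) := DFunLike.congr_fun h.eq ω
        rw [Submodule.mem_comap]
        change S (T ω) ∈ _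
        rw [this]
        exact mem_closedRange T _
      · exact (Submodule.isClosed_topologicalClosure _).preimage S.continuous
    exact this hζ
  have h1 := key h
  have h2 := congrArg star (key h')
  simp only [star_mul, star_star, (supportProj_isSelfAdjoint T).star_eq] at h2
  rw [mul_assoc] at h2
  exact h1.symm.trans h2

/-- The resolvents fix `ker A`, are `O(1/m)` on `ran A` because `m R A η = η - R η`, and are
contractions, so the limit zero passes to the closure of the range. -/
theorem tendsto_resolventInv (hA : 0 ≤ A) (ζ : L) :
    Tendsto (fun m => resolventInv A m ζ) atTop (𝓝 (ζ - supportProj A ζ)) := by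
  have hfix : ∀ m, resolventInv A m (ζ - supportProj A ζ) = ζ - supportProj A ζ := fun m => by
    have h1 := DFunLike.congr_fun (resolventInv_mul hA m) (ζ - supportProj A ζ)
    simpa [mul_apply_eq_comp, apply_sub_supportProj hA.isSelfAdjoint] using h1
  have hrange : ∀ η, Tendsto (fun m => resolventInv A m (A η)) atTop (𝓝 0) := fun η => by
    rw [tendsto_zero_iff_norm_tendsto_zero]
    refine squeeze_zero' (Eventually.of_forall fun _ => norm_nonneg _) ?_
      (tendsto_const_div_atTop_nhds_zero_nat (2 * ‖η‖))
    filter_upwards [eventually_gt_atTop 0] with m hm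
    have hm' : (0 : ℝ) < m := by exact_mod_cast hm
    rw [le_div_iff₀ hm']
    have h1 := DFunLike.congr_fun (one_sub_resolventInv hA m) η
    have h2 := DFunLike.congr_fun (commute_resolventInv (Commute.refl A) m).eq η
    simp only [sub_apply, one_apply_eq_self, smul_apply,
      mul_apply_eq_comp] at h1 h2
    rw [h2] at h1
    calc ‖resolventInv A m (A η)‖ * m = ‖(m : ℂ) • resolventInv A m (A η)‖ := by
          rw [norm_smul, mul_comm]; simp
      _ ≤ ‖η‖ + ‖resolventInv A m η‖ := by rw [← h1]; exact norm_sub_le _ _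
      _ ≤ 2 * ‖η‖ := by linarith [norm_resolventInv_apply_le hA m η]
  have hclosed : ∀ η ∈ closedRange A, Tendsto (fun m => resolventInv A m η) atTop (𝓝 0) := by
    intro η hη
    rw [Metric.tendsto_atTop]
    intro ε hε
    obtain ⟨_, ⟨ω, rfl⟩, hω⟩ := Metric.mem_closure_iff.mp hη (ε / 2) (by positivity)
    obtain ⟨m₀, hm₀⟩ := Metric.tendsto_atTop.mp (hrange ω) (ε / 2) (by positivity)
    refine ⟨m₀, fun m hm => ?_⟩
    have h1 := hm₀ m hm
    have h2 := norm_resolventInv_apply_le hA m (η - A ω)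
    rw [dist_zero_right] at h1 ⊢
    rw [dist_eq_norm] at hω
    calc ‖resolventInv A m η‖ = ‖resolventInv A m (η - A ω) + resolventInv A m (A ω)‖ := by
          rw [← map_add, sub_add_cancel]
      _ ≤ _ := norm_add_le _ _
      _ < ε := by
        change ‖η - A ω‖ < _ at hω
        linarith
  have h := (hclosed (supportProj A ζ) (Submodule.starProjection_apply_mem _ _)).const_add
    (ζ - supportProj A ζ)
  rw [add_zero] at h
  refine h.congr fun m => ?_
  conv_lhs => rw [← hfix m, ← map_add, sub_add_cancel]

theorem mul_one_sub_supportProj (hA : 0 ≤ A) (hAB : A + B = 1) :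
    B * (1 - supportProj A) = 1 - supportProj A := by
  rw [eq_sub_of_add_eq' hAB, sub_mul, one_mul, mul_sub, mul_one,
    mul_supportProj_self hA.isSelfAdjoint, sub_self, sub_zero]

theorem commute_supportProj_right (hA : 0 ≤ A) (hAB : A + B = 1) : Commute B (supportProj A) := by
  rw [eq_sub_of_add_eq' hAB]
  exact (Commute.one_left _).sub_left
    ((mul_supportProj_self hA.isSelfAdjoint).trans (supportProj_mul_self A).symm)

theorem tendsto_parallelDerivative (hA : 0 ≤ A) (hAB : A + B = 1) (ζ : L) :
    Tendsto (fun n => parallelDerivative A B n ζ) atTop (𝓝 ((B * supportProj A) ζ)) := by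
  rw [← tendsto_add_atTop_iff_nat 1]
  have h := ((B.continuous.tendsto _).comp (tendsto_resolventInv hA (B ζ))).const_sub (B ζ)
  have hP := commute_supportProj_right hA hAB
  have h3 := mul_one_sub_supportProj hA hAB
  have h4 : B ζ - B (B ζ - supportProj A (B ζ)) = (B * supportProj A) ζ := by
    have : B - B * ((1 - supportProj A) * B) = B * supportProj A := by
      rw [← mul_assoc, h3, sub_mul, one_mul, sub_sub_cancel, hP.eq]
    rw [← this]
    simp
  rw [h4] at h
  refine h.congr fun m => ?_
  simp [parallelDerivative]

end Operators

/-! ### Ultraweak convergence of sequences -/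

section Convergence

variable {K : Type v} [NormedAddCommGroup K] [InnerProductSpace ℂ K]

theorem tendsto_ultraweak_iff {F : ℕ → (K →L[ℂ] K)} {T : K →L[ℂ] K} :
    Tendsto F atTop (@nhds _ (ultraweakTopology K) T) ↔
      ∀ ξ η : lp (fun _ : ℕ => K) 2, Tendsto (fun n => ∑' k, ⟪ξ k, F n (η k)⟫_ℂ) atTop
        (𝓝 (∑' k, ⟪ξ k, T (η k)⟫_ℂ)) := by
  simp only [nhds_iInf, nhds_induced, tendsto_iInf, tendsto_comap_iff]
  rfl

theorem tendsto_inner_of_tendsto_ultraweak {F : ℕ → (K →L[ℂ] K)} {T : K →L[ℂ] K}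
    (h : Tendsto F atTop (@nhds _ (ultraweakTopology K) T)) (ξ η : K) :
    Tendsto (fun n => ⟪ξ, F n η⟫_ℂ) atTop (𝓝 ⟪ξ, T η⟫_ℂ) := by
  have hs : ∀ S : K →L[ℂ] K, ∑' k, ⟪(lp.single 2 0 ξ : lp (fun _ : ℕ => K) 2) k,
      S ((lp.single 2 0 η : lp (fun _ : ℕ => K) 2) k)⟫_ℂ = ⟪ξ, S η⟫_ℂ := fun S => by
    rw [tsum_eq_single 0 fun k hk => by rw [lp.single_apply_ne _ _ _ hk, inner_zero_left],
      lp.single_apply_self, lp.single_apply_self]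
  have := tendsto_ultraweak_iff.mp h (lp.single 2 0 ξ) (lp.single 2 0 η)
  simpa only [hs] using this

/-- The uniform boundedness principle supplies `C` with `‖F n‖ ≤ C`, and `C ‖ξ k‖ ‖η k‖` then
dominates the series. -/
theorem tendsto_ultraweak_of_strong [CompleteSpace K] {F : ℕ → (K →L[ℂ] K)} {T : K →L[ℂ] K}
    (h : ∀ ξ, Tendsto (fun n => F n ξ) atTop (𝓝 (T ξ))) :
    Tendsto F atTop (@nhds _ (ultraweakTopology K) T) := by
  obtain ⟨C, hC⟩ := banach_steinhaus (g := F) fun ξ => by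
    obtain ⟨C, hC⟩ := (Metric.isBounded_range_of_tendsto _ (h ξ)).exists_norm_le
    exact ⟨C, fun n => hC _ ⟨n, rfl⟩⟩
  rw [tendsto_ultraweak_iff]
  intro ξ η
  have hsum : Summable fun k => ‖ξ k‖ * ‖η k‖ := 
    lp.summable_mul (by norm_num [Real.holderConjugate_iff]) ξ η
  refine tendsto_tsum_of_dominated_convergence (hsum.mul_left C) (fun k => ?_)
    (Eventually.of_forall fun n k => ?_)
  · exact ((continuous_const.inner continuous_id).tendsto _).comp (h (η k))
  · calc _ ≤ ‖ξ k‖ * ‖F n (η k)‖ := norm_inner_le_norm _ _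
      _ ≤ ‖ξ k‖ * (C * ‖η k‖) := by gcongr; exact (F n).le_of_opNorm_le (hC n) _
      _ = _ := by ring

end Convergence

/-! ### Parallel sums, absolute continuity and singularity -/

section Maps

variable {H : Type u} [NormedAddCommGroup H] [InnerProductSpace ℂ H] [CompleteSpace H]
variable {K : Type v} [NormedAddCommGroup K] [InnerProductSpace ℂ K] [CompleteSpace K]
variable {L : Type w} [NormedAddCommGroup L] [InnerProductSpace ℂ L] [CompleteSpace L]
variable {M : VonNeumannAlgebra H} {N : VonNeumannAlgebra K}
variable {π : M →⋆ₐ[ℂ] (L →L[ℂ] L)} {V : K →L[ℂ] L} {Γ : M →ₗ[ℂ] N}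

theorem PointUltraweakTendsto.tendsto_sForm {F : ℕ → (M →CP N)} {G : M →CP N}
    (h : PointUltraweakTendsto F G) (z w : M ⊗[ℂ] K) :
    Tendsto (fun n => sForm (F n).toLinearMap z w) atTop (𝓝 (sForm G.toLinearMap z w)) := by
  induction z with
  | zero => simp
  | add z₁ z₂ h₁ h₂ => simpa only [map_add, LinearMap.add_apply] using h₁.add h₂
  | tmul y η =>
    induction w with
    | zero => simp
    | add w₁ w₂ h₁ h₂ => simpa only [map_add] using h₁.add h₂
    | tmul x ξ =>
      simp only [sForm_tmul]
      exact tendsto_inner_of_tendsto_ultraweak (h (star y * x)) η ξ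

theorem pointUltraweakTendsto_of_derivative {F : ℕ → (M →CP N)} {G : M →CP N}
    {S : ℕ → (L →L[ℂ] L)} {T : L →L[ℂ] L}
    (hF : ∀ n, IsArvesonDerivative π V (F n).toLinearMap (S n))
    (hG : IsArvesonDerivative π V G.toLinearMap T)
    (h : ∀ ζ, Tendsto (fun n => S n ζ) atTop (𝓝 (T ζ))) : PointUltraweakTendsto F G := by
  intro x
  refine tendsto_ultraweak_of_strong fun ξ => ?_
  have hF' : ∀ n, ((F n x : N) : K →L[ℂ] K) = _ := fun n => (hF n).eq_compression x
  have hG' : ((G x : N) : K →L[ℂ] K) = _ := hG.eq_compression x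
  simp only [hF', hG', ContinuousLinearMap.comp_apply]
  exact ((ContinuousLinearMap.adjoint V).continuous.tendsto _).comp (h _)

/-- A pointwise attained infimum of operator forms yields a parallel sum. -/
theorem IsMinimalStinespring.isParallelSum (hV : IsMinimalStinespring Γ π V) {f g θ : M →ₗ[ℂ] N}
    {a b t : L →L[ℂ] L} (hf : IsArvesonDerivative π V f a) (hg : IsArvesonDerivative π V g b)
    (hθ : IsArvesonDerivative π V θ t)
    (hle : ∀ w u, (⟪w, t w⟫_ℂ).re ≤ (⟪u, a u⟫_ℂ).re + (⟪w - u, b (w - u)⟫_ℂ).re)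
    (hex : ∀ w, ∃ u, (⟪u, a u⟫_ℂ).re + (⟪w - u, b (w - u)⟫_ℂ).re = (⟪w, t w⟫_ℂ).re) :
    IsParallelSum f g θ := by
  intro z
  constructor
  · rintro _ ⟨x, y, rfl, rfl⟩
    rw [hf.sForm_eq, hg.sForm_eq, hθ.sForm_eq]
    simpa using hle (stinespringMap π V (x + y)) (stinespringMap π V x)
  · intro r hr
    obtain ⟨u, hu⟩ := hex (stinespringMap π V z)
    rw [hθ.sForm_eq, ← hu]
    -- The minimizer `u` need not come from `M ⊙ K`; the lower bound `r` extends to it by density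
    -- and continuity.
    refine hV.denseRange.induction_on u (isClosed_le continuous_const ?_) fun x => ?_
    · exact (Complex.continuous_re.comp (by fun_prop)).add (Complex.continuous_re.comp (by fun_prop))
    · refine hr ⟨x, z - x, by abel, ?_⟩
      rw [hf.sForm_eq, hg.sForm_eq, map_sub (stinespringMap π V)]

variable {Φ Ψ : M →CP N} {A B : L →L[ℂ] L}

theorem isParallelSum_parallelDerivative (hV : IsMinimalStinespring Γ π V)
    (hΦ : IsArvesonDerivative π V Φ.toLinearMap A) (hΨ : IsArvesonDerivative π V Ψ.toLinearMap B)
    (hAB : A + B = 1) (n : ℕ) {θ : M →ₗ[ℂ] N}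
    (hθ : IsArvesonDerivative π V θ (parallelDerivative A B n)) :
    IsParallelSum ((n : ℂ) • Φ.toLinearMap) Ψ.toLinearMap θ := by
  have hA : 0 ≤ A := (ContinuousLinearMap.nonneg_iff_isPositive _).mpr hΦ.isPositive
  -- The minimizer solves `(nA + B) q = B w`. For `n = m + 1` it is `(1 + mA)⁻¹ B w`; for `n = 0`,
  -- where `B` may fail to be invertible, `q = w` works and the infimum is zero.
  have hsq : ∀ w, ∃ q, ∀ u, (⟪u, ((n : ℂ) • A) u⟫_ℂ).re + (⟪w - u, B (w - u)⟫_ℂ).re =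
      (⟪u - q, ((n : ℂ) • A) (u - q)⟫_ℂ).re + (⟪u - q, B (u - q)⟫_ℂ).re +
        (⟪w, parallelDerivative A B n w⟫_ℂ).re := by
    intro w
    cases n with
    | zero =>
      refine ⟨w, fun u => ?_⟩
      have : w - u = -(u - w) := by abel
      rw [this, map_neg, inner_neg_neg]
      generalize u - w = v
      simp [parallelDerivative]
    | succ m =>
      refine ⟨resolventInv A m (B w), fun u => ?_⟩
      have hq : (((m + 1 : ℕ) : ℂ) • A) (resolventInv A m (B w)) + B (resolventInv A m (B w)) =
          B w := by
        have h1 : ((m + 1 : ℕ) : ℂ) • A + B = 1 + (m : ℂ) • A := by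
          rw [← hAB]; push_cast; rw [add_smul, one_smul]; abel
        rw [← add_apply, h1, ← mul_apply_eq_comp, mul_resolventInv hA, one_apply_eq_self]
      have h2 := re_inner_add_re_inner (natCast_smul_nonneg hA (m + 1)).isSelfAdjoint
        hΨ.isPositive.isSelfAdjoint hq (u - resolventInv A m (B w))
      rw [sub_add_cancel] at h2
      rw [h2]
      simp [parallelDerivative]
  refine hV.isParallelSum (hΦ.natCast_smul n) hΨ hθ (fun w u => ?_) fun w => ?_
  · obtain ⟨q, hq⟩ := hsq w
    rw [hq u]
    have h1 := (hΦ.natCast_smul n).isPositive.re_inner_nonneg_right (u - q)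
    have h2 := hΨ.isPositive.re_inner_nonneg_right (u - q)
    rw [RCLike.re_eq_complex_re] at h1 h2
    linarith
  · obtain ⟨q, hq⟩ := hsq w
    exact ⟨q, by rw [hq q]; simp⟩

theorem add_eq_one (hV : IsMinimalStinespring (Φ.toLinearMap + Ψ.toLinearMap) π V)
    (hΦ : IsArvesonDerivative π V Φ.toLinearMap A) (hΨ : IsArvesonDerivative π V Ψ.toLinearMap B) :
    A + B = 1 :=
  hV.arvesonDerivative_unique (hΦ.add hΨ) hV.arvesonDerivative_one

theorem exists_parallelSum (hV : IsMinimalStinespring (Φ.toLinearMap + Ψ.toLinearMap) π V)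
    (hΦ : IsArvesonDerivative π V Φ.toLinearMap A) (hΨ : IsArvesonDerivative π V Ψ.toLinearMap B)
    (n : ℕ) : ∃ F : M →CP N, IsArvesonDerivative π V F.toLinearMap (parallelDerivative A B n) := by
  have hA : 0 ≤ A := (ContinuousLinearMap.nonneg_iff_isPositive _).mpr hΦ.isPositive
  have hB : 0 ≤ B := (ContinuousLinearMap.nonneg_iff_isPositive _).mpr hΨ.isPositive
  refine exists_of_mem_derivativeAlgebra hV (fun S hS => ?_)
    ((ContinuousLinearMap.nonneg_iff_isPositive _).mp
      (parallelDerivative_nonneg hA hB (add_eq_one hV hΦ hΨ) n))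
  exact commute_parallelDerivative (hΦ.mem_derivativeAlgebra hV S hS)
    (hΨ.mem_derivativeAlgebra hV S hS) n

theorem supportProj_mem_derivativeAlgebra (hV : IsMinimalStinespring Γ π V) {T : L →L[ℂ] L}
    (hT : T ∈ derivativeAlgebra N π V) : supportProj T ∈ derivativeAlgebra N π V :=
  fun S hS => commute_supportProj (hT S hS) (hT (star S) (star_mem_generators hV hS))

theorem supportProj_nonneg (T : L →L[ℂ] L) : 0 ≤ supportProj T := by
  have hid : IsIdempotentElem (supportProj T) :=
    Submodule.isIdempotentElem_starProjection (closedRange T)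
  have h := star_mul_self_nonneg (supportProj T)
  rwa [(supportProj_isSelfAdjoint T).star_eq, hid.eq] at h

theorem one_sub_supportProj_nonneg (T : L →L[ℂ] L) : 0 ≤ 1 - supportProj T := by
  have hid : IsIdempotentElem (1 - supportProj T) :=
    (Submodule.isIdempotentElem_starProjection (closedRange T)).one_sub
  have h := star_mul_self_nonneg (1 - supportProj T)
  rwa [star_sub, star_one, (supportProj_isSelfAdjoint T).star_eq, hid.eq] at h

/-- `B P` is the derivative of the absolutely continuous part. -/
theorem exists_derivative_mul_supportProj
    (hV : IsMinimalStinespring (Φ.toLinearMap + Ψ.toLinearMap) π V)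
    (hΦ : IsArvesonDerivative π V Φ.toLinearMap A) (hΨ : IsArvesonDerivative π V Ψ.toLinearMap B) :
    ∃ F : M →CP N, IsArvesonDerivative π V F.toLinearMap (B * supportProj A) := by
  have hA : 0 ≤ A := (ContinuousLinearMap.nonneg_iff_isPositive _).mpr hΦ.isPositive
  have hB : 0 ≤ B := (ContinuousLinearMap.nonneg_iff_isPositive _).mpr hΨ.isPositive
  refine exists_of_mem_derivativeAlgebra hV
    (Set.mul_mem_centralizer (hΨ.mem_derivativeAlgebra hV)
      (supportProj_mem_derivativeAlgebra hV (hΦ.mem_derivativeAlgebra hV)))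
    ((ContinuousLinearMap.nonneg_iff_isPositive _).mp ?_)
  exact (commute_supportProj_right hA (add_eq_one hV hΦ hΨ)).mul_nonneg hB (supportProj_nonneg A)

theorem exists_derivative_one_sub_supportProj
    (hV : IsMinimalStinespring Γ π V) (hΦ : IsArvesonDerivative π V Φ.toLinearMap A) :
    ∃ F : M →CP N, IsArvesonDerivative π V F.toLinearMap (1 - supportProj A) := by
  refine exists_of_mem_derivativeAlgebra hV (fun S hS => ?_)
    ((ContinuousLinearMap.nonneg_iff_isPositive _).mp (one_sub_supportProj_nonneg A))
  exact (Commute.one_right S).sub_right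
    (supportProj_mem_derivativeAlgebra hV (hΦ.mem_derivativeAlgebra hV) S hS)

theorem IsParallelSum.sForm_self_eq {f g θ θ' : M →ₗ[ℂ] N} (h : IsParallelSum f g θ)
    (h' : IsParallelSum f g θ') (z : M ⊗[ℂ] K) : (sForm θ z z).re = (sForm θ' z z).re :=
  (h z).unique (h' z)

/-- The approximants are prescribed only through their quadratic forms, which already determine
their derivatives; the limit is therefore the same for every choice. -/
theorem IsAbsolutelyContinuousPart.derivative
    (hV : IsMinimalStinespring (Φ.toLinearMap + Ψ.toLinearMap) π V)
    (hΦ : IsArvesonDerivative π V Φ.toLinearMap A) (hΨ : IsArvesonDerivative π V Ψ.toLinearMap B)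
    {Ψac : M →CP N} (h : IsAbsolutelyContinuousPart Φ Ψ Ψac) :
    IsArvesonDerivative π V Ψac.toLinearMap (B * supportProj A) := by
  have hA : 0 ≤ A := (ContinuousLinearMap.nonneg_iff_isPositive _).mpr hΦ.isPositive
  have hAB := add_eq_one hV hΦ hΨ
  obtain ⟨F, hF, hlim⟩ := h
  have hFn : ∀ n, IsArvesonDerivative π V (F n).toLinearMap (parallelDerivative A B n) := fun n => by
    obtain ⟨F', hF'⟩ := exists_parallelSum hV hΦ hΨ n
    exact hV.derivative_of_sForm_self_eq hF' (F n)
      ((hF n).sForm_self_eq (isParallelSum_parallelDerivative hV hΦ hΨ hAB n hF'))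
  obtain ⟨G, hG⟩ := exists_derivative_mul_supportProj hV hΦ hΨ
  refine isArvesonDerivative_of_sForm_eq hG.mem_commutant hG.isPositive fun z w => ?_
  refine tendsto_nhds_unique (hlim.tendsto_sForm z w) ?_
  simp only [(hFn _).sForm_eq]
  exact ((continuous_const.inner continuous_id).tendsto _).comp (tendsto_parallelDerivative hA hAB _)

theorem isAbsolutelyContinuousPart_of_derivative
    (hV : IsMinimalStinespring (Φ.toLinearMap + Ψ.toLinearMap) π V)
    (hΦ : IsArvesonDerivative π V Φ.toLinearMap A) (hΨ : IsArvesonDerivative π V Ψ.toLinearMap B)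
    {Ψac : M →CP N} (h : IsArvesonDerivative π V Ψac.toLinearMap (B * supportProj A)) :
    IsAbsolutelyContinuousPart Φ Ψ Ψac := by
  have hA : 0 ≤ A := (ContinuousLinearMap.nonneg_iff_isPositive _).mpr hΦ.isPositive
  have hAB := add_eq_one hV hΦ hΨ
  choose F hF using exists_parallelSum hV hΦ hΨ
  exact ⟨F, fun n => isParallelSum_parallelDerivative hV hΦ hΨ hAB n (hF n),
    pointUltraweakTendsto_of_derivative hF h (tendsto_parallelDerivative hA hAB)⟩

theorem absolutelyContinuous_of_derivative
    (hV : IsMinimalStinespring (Φ.toLinearMap + Ψ.toLinearMap) π V)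
    (hΦ : IsArvesonDerivative π V Φ.toLinearMap A) (hΨ : IsArvesonDerivative π V Ψ.toLinearMap B)
    {Ψac : M →CP N} (h : IsArvesonDerivative π V Ψac.toLinearMap (B * supportProj A)) :
    AbsolutelyContinuous Ψac Φ := by
  have hA : 0 ≤ A := (ContinuousLinearMap.nonneg_iff_isPositive _).mpr hΦ.isPositive
  have hB : 0 ≤ B := (ContinuousLinearMap.nonneg_iff_isPositive _).mpr hΨ.isPositive
  have hAB := add_eq_one hV hΦ hΨ
  choose F hF using exists_parallelSum hV hΦ hΨ
  -- `n + 1` rather than `n`, so that the constant is positive at `n = 0`.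
  refine ⟨F, fun n => n + 1, fun n => ?_,
    pointUltraweakTendsto_of_derivative hF h (tendsto_parallelDerivative hA hAB),
    fun n => ⟨by positivity, ?_⟩⟩
  · exact cpLe_of_le (hF n) (hF (n + 1)) (parallelDerivative_mono hA hB hAB n)
  · have h1 : parallelDerivative A B n ≤ ((n + 1 : ℕ) : ℂ) • A := by
      refine (parallelDerivative_le hA hAB n).trans ?_
      rw [Nat.cast_succ, add_smul, one_smul]
      exact le_add_of_nonneg_right hA
    have h2 := cpLe_of_le (hF n) (hΦ.natCast_smul (n + 1)) h1
    simpa using h2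

theorem apply_eq_zero_of_re_inner_eq_zero {T : L →L[ℂ] L} (hT : 0 ≤ T) {ζ : L}
    (h : (⟪ζ, T ζ⟫_ℂ).re ≤ 0) : T ζ = 0 := by
  obtain ⟨S, rfl⟩ := exists_eq_star_mul_self hT
  rw [mul_apply_eq_comp, ContinuousLinearMap.star_eq_adjoint,
    ContinuousLinearMap.adjoint_inner_right] at h
  have h1 := inner_self_eq_norm_sq (𝕜 := ℂ) (S ζ)
  rw [RCLike.re_eq_complex_re] at h1
  have h2 : ‖S ζ‖ = 0 := by nlinarith [norm_nonneg (S ζ)]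
  rw [mul_apply_eq_comp, norm_eq_zero.mp h2, map_zero]

theorem apply_eq_zero_of_le {S T : L →L[ℂ] L} (hS : 0 ≤ S) (h : S ≤ T) {ζ : L} (hζ : T ζ = 0) :
    S ζ = 0 := by
  refine apply_eq_zero_of_re_inner_eq_zero hS ((re_inner_le_of_le h ζ).trans ?_)
  simp [hζ]

/-- The parallelogram law for the form of `D`, with one nonnegative term dropped. -/
theorem re_inner_le_two_mul {D : L →L[ℂ] L} (hD : 0 ≤ D) (u v : L) :
    (⟪u, D u⟫_ℂ).re ≤ 2 * (⟪v, D v⟫_ℂ).re + 2 * (⟪u - v, D (u - v)⟫_ℂ).re := by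
  have h := ((ContinuousLinearMap.nonneg_iff_isPositive _).mp hD).re_inner_nonneg_right
    ((u - v) - v)
  have h' : u = (u - v) + v := by abel
  rw [RCLike.re_eq_complex_re] at h
  generalize hx : u - v = x at *
  subst h'
  simp only [map_add, map_sub, inner_add_left, inner_add_right, inner_sub_left, inner_sub_right,
    Complex.add_re, Complex.sub_re] at *
  linarith

theorem exists_derivative_of_sForm_le
    (hV : IsMinimalStinespring (Φ.toLinearMap + Ψ.toLinearMap) π V) (Θ : M →CP N)
    (h : ∀ z : M ⊗[ℂ] K, (sForm Θ.toLinearMap z z).re ≤ (sForm Φ.toLinearMap z z).re ∨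
      (sForm Θ.toLinearMap z z).re ≤ (sForm Ψ.toLinearMap z z).re) :
    ∃ T, IsArvesonDerivative π V Θ.toLinearMap T :=
  hV.exists_arvesonDerivative Θ 1 fun z => by
    rw [sForm_add, Complex.add_re]
    rcases h z with h | h <;> linarith [sForm_self_nonneg Φ z, sForm_self_nonneg Ψ z]

theorem closedRange_le_of_ker {S T : L →L[ℂ] L} (hS : IsSelfAdjoint S) (hT : IsSelfAdjoint T)
    (h : ∀ ζ, T ζ = 0 → S ζ = 0) : closedRange S ≤ closedRange T := by
  have h1 : (closedRange T)ᗮ ≤ (closedRange S)ᗮ := fun ζ hζ =>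
    (closedRange_orthogonal hS ζ).mpr (h ζ ((closedRange_orthogonal hT ζ).mp hζ))
  have h2 := Submodule.orthogonal_le h1
  rwa [Submodule.orthogonal_orthogonal, Submodule.orthogonal_orthogonal] at h2

/-- Let `T n` be the derivatives of the approximants. If `A u = 0`, then `T n u = 0`, so `⟪u, B u⟫ =
⟪u, (B - T n) u⟫`. Convergence of forms is known only on the dense range, but `0 ≤ B - T n ≤ 1`
uniformly, so replacing `u` by a nearby `v` there is harmless. -/
theorem closedRange_le_of_absolutelyContinuous
    (hV : IsMinimalStinespring (Φ.toLinearMap + Ψ.toLinearMap) π V)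
    (hΦ : IsArvesonDerivative π V Φ.toLinearMap A) (hΨ : IsArvesonDerivative π V Ψ.toLinearMap B)
    (h : AbsolutelyContinuous Ψ Φ) : closedRange B ≤ closedRange A := by
  have hA : 0 ≤ A := (ContinuousLinearMap.nonneg_iff_isPositive _).mpr hΦ.isPositive
  have hB : 0 ≤ B := (ContinuousLinearMap.nonneg_iff_isPositive _).mpr hΨ.isPositive
  have hAB := add_eq_one hV hΦ hΨ
  obtain ⟨F, α, hmono, hlim, hα⟩ := h
  have hFΨ : ∀ n (z : M ⊗[ℂ] K),
      (sForm (F n).toLinearMap z z).re ≤ (sForm Ψ.toLinearMap z z).re := fun n z =>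
    (monotone_nat_of_le_succ fun n => (hmono n).sForm_le z).ge_of_tendsto
      ((Complex.continuous_re.tendsto _).comp (hlim.tendsto_sForm z z)) n
  choose T hT using fun n => exists_derivative_of_sForm_le hV (F n) fun z => Or.inr (hFΨ n z)
  have hT0 : ∀ n, 0 ≤ T n := fun n =>
    (ContinuousLinearMap.nonneg_iff_isPositive _).mpr (hT n).isPositive
  have hTB : ∀ n, T n ≤ B := fun n => hV.le_of_sForm_le (hT n) hΨ (hFΨ n)
  -- Rounding `α n` up costs nothing, as only `ker A` matters, and gives a natural multiple of `Φ`.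
  have hTA : ∀ n, T n ≤ ((⌈α n⌉₊ : ℕ) : ℂ) • A := fun n => by
    refine hV.le_of_sForm_le (hT n) (hΦ.natCast_smul _) fun z => ((hα n).2.sForm_le z).trans ?_
    rw [sForm_smul, sForm_smul, Complex.re_ofReal_mul, ← Complex.ofReal_natCast,
      Complex.re_ofReal_mul]
    exact mul_le_mul_of_nonneg_right (Nat.le_ceil _) (sForm_self_nonneg Φ z)
  refine closedRange_le_of_ker hB.isSelfAdjoint hA.isSelfAdjoint fun u hu => ?_
  refine apply_eq_zero_of_re_inner_eq_zero hB ?_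
  have hTu : ∀ n, T n u = 0 := fun n =>
    apply_eq_zero_of_le (hT0 n) (hTA n) (by rw [smul_apply, hu, smul_zero])
  have hB1 : B ≤ 1 := by rw [← hAB]; exact le_add_of_nonneg_left hA
  have key : ∀ v, (⟪u, B u⟫_ℂ).re ≤ 2 * ‖u - v‖ ^ 2 := fun v => by
    refine hV.denseRange.induction_on v (isClosed_le continuous_const (by fun_prop)) fun z => ?_
    have hlim' : Tendsto (fun n => 2 * ((sForm Ψ.toLinearMap z z).re -
        (sForm (F n).toLinearMap z z).re) + 2 * ‖u - stinespringMap π V z‖ ^ 2) atTop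
        (𝓝 (2 * ((sForm Ψ.toLinearMap z z).re - (sForm Ψ.toLinearMap z z).re) +
          2 * ‖u - stinespringMap π V z‖ ^ 2)) :=
      ((((Complex.continuous_re.tendsto _).comp (hlim.tendsto_sForm z z)).const_sub _).const_mul
        2).add_const _
    rw [sub_self, mul_zero, zero_add] at hlim'
    refine ge_of_tendsto' hlim' fun n => ?_
    have h1 := re_inner_le_two_mul (sub_nonneg.mpr (hTB n)) u (stinespringMap π V z)
    have h2 : B - T n ≤ 1 := (sub_le_self B (hT0 n)).trans hB1
    have h3 := re_inner_le_of_le h2 (u - stinespringMap π V z)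
    have h4 := inner_self_eq_norm_sq (𝕜 := ℂ) (u - stinespringMap π V z)
    rw [RCLike.re_eq_complex_re] at h4
    rw [one_apply_eq_self, h4] at h3
    rw [hΨ.sForm_eq, (hT n).sForm_eq, ← Complex.sub_re, ← inner_sub_right, ← sub_apply]
    rw [sub_apply B (T n) u, hTu n, sub_zero] at h1
    linarith
  simpa using key u

theorem absolutelyContinuous_iff
    (hV : IsMinimalStinespring (Φ.toLinearMap + Ψ.toLinearMap) π V)
    (hΦ : IsArvesonDerivative π V Φ.toLinearMap A) (hΨ : IsArvesonDerivative π V Ψ.toLinearMap B) :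
    AbsolutelyContinuous Ψ Φ ↔ closedRange B ≤ closedRange A := by
  refine ⟨closedRange_le_of_absolutelyContinuous hV hΦ hΨ, fun h => ?_⟩
  have hA : 0 ≤ A := (ContinuousLinearMap.nonneg_iff_isPositive _).mpr hΦ.isPositive
  refine absolutelyContinuous_of_derivative hV hΦ hΨ ?_
  have : B * supportProj A = B := by
    rw [(commute_supportProj_right hA (add_eq_one hV hΦ hΨ)).eq]
    refine ContinuousLinearMap.ext fun ζ => ?_
    exact Submodule.starProjection_eq_self_iff.mpr (h (mem_closedRange B ζ))
  rwa [this]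

theorem derivative_eq_zero_iff {T : L →L[ℂ] L} (hV : IsMinimalStinespring Γ π V) {f : M →ₗ[ℂ] N}
    (hT : IsArvesonDerivative π V f T) : f = 0 ↔ T = 0 := by
  have h0 : IsArvesonDerivative π V (0 : M →ₗ[ℂ] N) 0 :=
    ⟨Set.zero_mem_centralizer, ContinuousLinearMap.isPositive_zero, fun x => by simp⟩
  constructor
  · rintro rfl
    exact hV.arvesonDerivative_unique hT h0
  · rintro rfl
    exact hT.eq_of_derivative h0

/-- A derivative below `A` vanishes on `ker A`, and one below `1 - P` vanishes on the range of `P`;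
together these fill `L`. -/
theorem singular_of_derivative
    (hV : IsMinimalStinespring (Φ.toLinearMap + Ψ.toLinearMap) π V)
    (hΦ : IsArvesonDerivative π V Φ.toLinearMap A) {Ψs : M →CP N}
    (h : IsArvesonDerivative π V Ψs.toLinearMap (1 - supportProj A)) : Singular Ψs Φ := by
  intro Θ hΘΦ hΘΨ
  obtain ⟨T, hT⟩ := exists_derivative_of_sForm_le hV Θ fun z => Or.inl (hΘΦ.sForm_le z)
  have hT0 : 0 ≤ T := (ContinuousLinearMap.nonneg_iff_isPositive _).mpr hT.isPositive
  rw [derivative_eq_zero_iff hV hT]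
  refine ContinuousLinearMap.ext fun ζ => ?_
  have h1 : T (ζ - supportProj A ζ) = 0 :=
    apply_eq_zero_of_le hT0 (hV.le_of_sForm_le hT hΦ hΘΦ.sForm_le)
      (apply_sub_supportProj hΦ.isPositive.isSelfAdjoint ζ)
  have h2 : T (supportProj A ζ) = 0 := by
    refine apply_eq_zero_of_le hT0 (hV.le_of_sForm_le hT h hΘΨ.sForm_le) ?_
    have : supportProj A (supportProj A ζ) = supportProj A ζ :=
      Submodule.starProjection_eq_self_iff.mpr (Submodule.starProjection_apply_mem _ _)
    rw [sub_apply, this, one_apply_eq_self, sub_self]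
  rw [map_sub, h2, sub_zero] at h1
  exact h1

theorem isOrtho_closedRange_iff {S T : L →L[ℂ] L} (hT : IsSelfAdjoint T) :
    closedRange S ⟂ closedRange T ↔ T * S = 0 := by
  rw [Submodule.isOrtho_iff_le]
  constructor
  · exact fun h => ContinuousLinearMap.ext fun ζ =>
      (closedRange_orthogonal hT _).mp (h (mem_closedRange S ζ))
  · intro h
    refine Submodule.topologicalClosure_minimal _ ?_ (Submodule.isClosed_orthogonal _)
    rintro _ ⟨ζ, rfl⟩
    exact (closedRange_orthogonal hT _).mpr (DFunLike.congr_fun h ζ)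

theorem singular_iff
    (hV : IsMinimalStinespring (Φ.toLinearMap + Ψ.toLinearMap) π V)
    (hΦ : IsArvesonDerivative π V Φ.toLinearMap A) (hΨ : IsArvesonDerivative π V Ψ.toLinearMap B) :
    Singular Ψ Φ ↔ closedRange B ⟂ closedRange A := by
  have hA : 0 ≤ A := (ContinuousLinearMap.nonneg_iff_isPositive _).mpr hΦ.isPositive
  have hB : 0 ≤ B := (ContinuousLinearMap.nonneg_iff_isPositive _).mpr hΨ.isPositive
  have hAB := add_eq_one hV hΦ hΨ
  have hcomm := commute_of_add_eq_one hAB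
  constructor
  · intro h
    -- The test map has derivative `AB`: here `A - AB = A²` and `B - AB = B²` are positive.
    obtain ⟨Θ, hΘ⟩ := exists_of_mem_derivativeAlgebra hV
      (Set.mul_mem_centralizer (hΦ.mem_derivativeAlgebra hV) (hΨ.mem_derivativeAlgebra hV))
      ((ContinuousLinearMap.nonneg_iff_isPositive _).mp (hcomm.mul_nonneg hA hB))
    have h1 : A * B ≤ A := by
      rw [← sub_nonneg, eq_sub_of_add_eq' hAB, mul_sub, mul_one, sub_sub_cancel]
      exact (Commute.refl A).mul_nonneg hA hA
    have h2 : A * B ≤ B := by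
      rw [← sub_nonneg, eq_sub_of_add_eq hAB, sub_mul, one_mul, sub_sub_cancel]
      exact (Commute.refl B).mul_nonneg hB hB
    rw [isOrtho_closedRange_iff hA.isSelfAdjoint, ← derivative_eq_zero_iff hV hΘ]
    exact h Θ (cpLe_of_le hΘ hΦ h1) (cpLe_of_le hΘ hΨ h2)
  · intro h
    have h1 : B * supportProj A = 0 := ContinuousLinearMap.ext fun ζ =>
      (closedRange_orthogonal hB.isSelfAdjoint _).mp
        (Submodule.isOrtho_iff_le.mp h.symm (Submodule.starProjection_apply_mem _ _))
    -- Orthogonality gives `BP = 0`, while `B(1 - P) = 1 - P` always holds.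
    have h2 : B = 1 - supportProj A := by
      have := mul_one_sub_supportProj hA hAB
      rwa [mul_sub, mul_one, h1, sub_zero] at this
    exact singular_of_derivative hV hΦ (h2 ▸ hΨ)

end Maps
end CPLebesgue

/-! ### The main theorem -/

open CPLebesgue in
theorem mainTheorem2
    {H : Type u} [NormedAddCommGroup H] [InnerProductSpace ℂ H] [CompleteSpace H]
    {K : Type v} [NormedAddCommGroup K] [InnerProductSpace ℂ K] [CompleteSpace K]
    {L : Type w} [NormedAddCommGroup L] [InnerProductSpace ℂ L] [CompleteSpace L]
    (M : VonNeumannAlgebra H) (N : VonNeumannAlgebra K) (Φ Ψ : M →CP N)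
    (π : M →⋆ₐ[ℂ] (L →L[ℂ] L)) (V : K →L[ℂ] L)
    (hV : CPLebesgue.IsMinimalStinespring (Φ.toLinearMap + Ψ.toLinearMap) π V) :
    (∃! A : L →L[ℂ] L, CPLebesgue.IsArvesonDerivative π V Φ.toLinearMap A) ∧
    (∃! B : L →L[ℂ] L, CPLebesgue.IsArvesonDerivative π V Ψ.toLinearMap B) ∧
    (∃ Ψac Ψs : M →CP N, CPLebesgue.IsLebesgueDecomposition Φ Ψ Ψac Ψs) ∧
    ∀ A B : L →L[ℂ] L,
      CPLebesgue.IsArvesonDerivative π V Φ.toLinearMap A →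
      CPLebesgue.IsArvesonDerivative π V Ψ.toLinearMap B →
      (CPLebesgue.supportProj A ∈ CPLebesgue.repCommutant π ∧
        CPLebesgue.supportProj B ∈ CPLebesgue.repCommutant π) ∧
      (∀ Ψac Ψs : M →CP N, CPLebesgue.IsLebesgueDecomposition Φ Ψ Ψac Ψs →
        CPLebesgue.AbsolutelyContinuous Ψac Φ ∧ CPLebesgue.Singular Ψs Φ ∧
        ∀ x : M,
          ((Ψac x : N) : K →L[ℂ] K) = ContinuousLinearMap.adjoint V ∘L
            (CPLebesgue.supportProj A * B * CPLebesgue.supportProj A) ∘L π x ∘L V ∧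
          ((Ψs x : N) : K →L[ℂ] K) = ContinuousLinearMap.adjoint V ∘L
            ((1 - CPLebesgue.supportProj A) * B * (1 - CPLebesgue.supportProj A)) ∘L
              π x ∘L V) ∧
      ((CPLebesgue.AbsolutelyContinuous Ψ Φ ↔
          CPLebesgue.closedRange B ≤ CPLebesgue.closedRange A) ∧
        (CPLebesgue.closedRange B ≤ CPLebesgue.closedRange A ↔
          CPLebesgue.supportProj B ≤ CPLebesgue.supportProj A)) ∧
      ((CPLebesgue.Singular Ψ Φ ↔
          CPLebesgue.closedRange B ⟂ CPLebesgue.closedRange A) ∧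
        (CPLebesgue.closedRange B ⟂ CPLebesgue.closedRange A ↔
          CPLebesgue.supportProj B * CPLebesgue.supportProj A = 0)) := by
  obtain ⟨A₀, hA₀⟩ := exists_derivative_of_sForm_le hV Φ fun z => Or.inl le_rfl
  obtain ⟨B₀, hB₀⟩ := exists_derivative_of_sForm_le hV Ψ fun z => Or.inr le_rfl
  refine ⟨⟨A₀, hA₀, fun A hA => hV.arvesonDerivative_unique hA hA₀⟩,
    ⟨B₀, hB₀, fun B hB => hV.arvesonDerivative_unique hB hB₀⟩, ?_, ?_⟩
  · obtain ⟨Ψac, hac⟩ := exists_derivative_mul_supportProj hV hA₀ hB₀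
    obtain ⟨Ψs, hs⟩ := exists_derivative_one_sub_supportProj hV hA₀
    refine ⟨Ψac, Ψs, isAbsolutelyContinuousPart_of_derivative hV hA₀ hB₀ hac, ?_⟩
    refine hB₀.eq_of_derivative (T := B₀) ?_
    have h := mul_one_sub_supportProj ((ContinuousLinearMap.nonneg_iff_isPositive _).mpr
      hA₀.isPositive) (add_eq_one hV hA₀ hB₀)
    have h' : B₀ * supportProj A₀ + (1 - supportProj A₀) = B₀ := by
      rw [← h, ← mul_add, add_sub_cancel, mul_one]
    exact h' ▸ hac.add hs
  · intro A B hA hB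
    have hA0 : 0 ≤ A := (ContinuousLinearMap.nonneg_iff_isPositive _).mpr hA.isPositive
    have hAB := add_eq_one hV hA hB
    refine ⟨⟨derivativeAlgebra_subset (supportProj_mem_derivativeAlgebra hV
      (hA.mem_derivativeAlgebra hV)), derivativeAlgebra_subset
      (supportProj_mem_derivativeAlgebra hV (hB.mem_derivativeAlgebra hV))⟩, ?_,
      ⟨absolutelyContinuous_iff hV hA hB,
        Submodule.starProjection_le_starProjection_iff.symm⟩, singular_iff hV hA hB,
      Submodule.starProjection_comp_starProjection_eq_zero_iff.symm⟩
    rintro Ψac Ψs ⟨hac, hadd⟩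
    have hac' := hac.derivative hV hA hB
    have hmul := mul_one_sub_supportProj hA0 hAB
    have hid : IsIdempotentElem (supportProj A) :=
      Submodule.isIdempotentElem_starProjection (closedRange A)
    have hs' : IsArvesonDerivative π V Ψs.toLinearMap (1 - supportProj A) := by
      obtain ⟨F, hF⟩ := exists_derivative_one_sub_supportProj hV hA
      refine isArvesonDerivative_of_sForm_eq hF.mem_commutant hF.isPositive fun z w => ?_
      have h1 : Ψs.toLinearMap = Ψ.toLinearMap - Ψac.toLinearMap := by rw [hadd]; abel
      rw [h1, sForm_sub, hB.sForm_eq, hac'.sForm_eq, ← inner_sub_right, ← hmul, mul_sub, mul_one]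
      rfl
    refine ⟨absolutelyContinuous_of_derivative hV hA hB hac', singular_of_derivative hV hA hs',
      fun x => ⟨?_, ?_⟩⟩
    -- The symmetric expressions collapse: `P B P = B P` by commutation, and `(1 - P) B (1 - P) = 1
    -- - P` because `B` is the identity on `ker A`.
    · rw [← (commute_supportProj_right hA0 hAB).eq, mul_assoc, hid.eq]
      exact hac'.eq_compression x
    · rw [mul_assoc, hmul, hid.one_sub.eq]
      exact hs'.eq_compression x
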